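/- Let $\mathcal A$ be a unital $C^*$-algebra and let $H_{\mathcal A}$ be the standard (right) Hilbert $\mathcal A$-module, consisting of all sequences $x=(\xi_1,\xi_2,\dots)$ in $\mathcal A$ for which $\sum_j\xi_j^*\xi_j$ converges in norm, with inner product $\langle x,y\rangle=\sum_j\xi_j^*\eta_j$ and norm $\|x\|=\|\langle x,x\rangle\|^{1/2}$. Let $B^a(H_{\mathcal A})$ be the set of bounded adjointable $\mathcal A$-linear operators on $H_{\mathcal A}$. An operator is called $\mathcal A$-compact if it lies in the norm closure of the set of finite sums of operators $x\mapsto y\langle z,x\rangle$ with $y,z\in H_{\mathcal A}$. A sequence $X=(x_i)_{i\ge1}$ in $H_{\mathcal A}$ is called admissible if $\|x_i\|\le1$ for all $i$ and, for every $x\in H_{\mathcal A}$, the series $\sum_i\langle x,x_i\rangle\langle x_i,x\rangle$ converges in norm with sum at most $\langle x,x\rangle$. For an admissible $X$ and a sequence $\Phi=(\varphi_k)_{k\ge1}$ of states on $\mathcal A$ put $$p_{X,\Phi}(x)=\Bigl(\sup_k\sum_{i\ge k}|\varphi_k(\langle x,x_i\rangle)|^2\Bigr)^{1/2},\qquad d_{X,\Phi}(x,y)=p_{X,\Phi}(x-y).$$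 For a pseudometric $d$ on $H_{\mathcal A}$ and $E\subseteq H_{\mathcal A}$ let * $\chi_d(E)$ be the infimum of all $\varepsilon>0$ such that $E$ is covered by finitely many open $d$-balls of radius $\varepsilon$ (with centres in $H_{\mathcal A}$); * $\alpha_d(E)$ be the infimum of all $\varepsilon>0$ such that $E$ is a finite union of sets of $d$-diameter less than $\varepsilon$; * $I_d(E)$ be the supremum of all $\varepsilon>0$ such that there is an infinite $S\subseteq E$ with $d(x,y)\ge\varepsilon$ for all distinct $x,y\in S$ (and $0$ if there is no such $\varepsilon$). For $\mu\in\{\chi,\alpha,I\}$ put $\mu^*(E)=\sup_{X,\Phi}\mu_{d_{X,\Phi}}(E)$, the supremum being over all admissible $X$ and all sequences $\Phi$ of states (and $0$ if $\mathcal A=0$). Put $\lambda(E)=\inf_L\sup_{x\in E}\inf_{y\in L}\|x-y\|$, where $L$ runs over the closed submodules of $H_{\mathcal A}$ that are finitely generated and projective. For $T\in B^a(H_{\mathcal A})$ put $\mu_o^*(T)=\mu^*(T(B_1))$ and $\lambda_o(T)=\lambda(T(B_1))$, where $B_1$ is the closed unit ball of $H_{\mathcal A}$. Let $T,S\in B^a(H_{\mathcal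 A})$. Then: a) for each $\mu\in\{\chi,\alpha,I\}$, $\mu_o^*(T+S)\le\mu_o^*(T)+\mu_o^*(S)$, and $\mu_o^*(cT)=c\,\mu_o^*(T)$ for all real $c>0$; b), f) $\chi_o^*(T)=\lambda_o(T)\le I_o^*(T)\le\alpha_o^*(T)\le2\chi_o^*(T)$; c) $\chi_o^*(T)\le\|T\|$, $\alpha_o^*(T)\le2\|T\|$ and $I_o^*(T)\le2\|T\|$; d) $T$ is $\mathcal A$-compact if and only if $\lambda_o(T)=0$, and, for each $\mu\in\{\chi,\alpha,I\}$, if and only if $\mu_o^*(T)=0$; e) $\lambda_o(T+K)=\lambda_o(T)$ and, for each $\mu\in\{\chi,\alpha,I\}$, $\mu_o^*(T+K)=\mu_o^*(T)$, for every $\mathcal A$-compact operator $K$ on $H_{\mathcal A}$. -/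

import Mathlib

open scoped ComplexOrder ENNReal

namespace HilbertMNC

noncomputable section

section StandardModule

/-! ### The standard Hilbert module over a unital `C*`-algebra -/

/-- `‖∑_{i ∈ s} ξ_i* ξ_i‖^{1/2}` for a finite set `s` of indices. -/
def finNorm {A : Type*} [CStarAlgebra A] (s : Finset ℕ) (x : ℕ → A) : ℝ :=
  √‖∑ i ∈ s, star (x i) * x i‖

theorem finNorm_add_le {A : Type*} [CStarAlgebra A] [PartialOrder A] [StarOrderedRing A]
    (s : Finset ℕ) (x y : ℕ → A) : finNorm s (x + y) ≤ finNorm s x + finNorm s y := by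
  have key : ∀ z : ℕ → A, finNorm s z
      = ‖((WithCStarModule.equiv A (s → A)).symm (fun i => star (z i)))‖ := by
    intro z
    rw [WithCStarModule.pi_norm, finNorm]
    congr 2
    rw [← Finset.sum_coe_sort]
    refine Finset.sum_congr rfl fun i _ => ?_
    simp [WithCStarModule.inner_def]
  rw [key, key, key]
  refine le_trans (le_of_eq ?_) (norm_add_le _ _)
  congr 1
  ext i
  simp

theorem finNorm_le_of_subset {A : Type*} [CStarAlgebra A] [PartialOrder A] [StarOrderedRing A]
    {s t : Finset ℕ} (h : s ⊆ t) (x : ℕ → A) : finNorm s x ≤ finNorm t x := by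
  refine Real.sqrt_le_sqrt ?_
  refine CStarAlgebra.norm_le_norm_of_nonneg_of_le
    (Finset.sum_nonneg fun i _ => star_mul_self_nonneg _) ?_
  exact Finset.sum_le_sum_of_subset_of_nonneg h fun i _ _ => star_mul_self_nonneg _

theorem summable_add {A : Type*} [CStarAlgebra A] [PartialOrder A] [StarOrderedRing A]
    {x y : ℕ → A} (hx : Summable fun i => star (x i) * x i)
    (hy : Summable fun i => star (y i) * y i) :
    Summable fun i => star ((x + y) i) * (x + y) i := by
  rw [summable_iff_vanishing_norm] at hx hy ⊢
  intro ε hε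
  have hδ : 0 < (√ε / 2) ^ 2 := by positivity
  obtain ⟨s, hs⟩ := hx _ hδ
  obtain ⟨t, ht⟩ := hy _ hδ
  refine ⟨s ∪ t, fun u hu => ?_⟩
  have h1 : finNorm u x < √ε / 2 := by
    rw [finNorm, Real.sqrt_lt' (by positivity)]
    exact hs u (Finset.disjoint_of_subset_right Finset.subset_union_left hu)
  have h2 : finNorm u y < √ε / 2 := by
    rw [finNorm, Real.sqrt_lt' (by positivity)]
    exact ht u (Finset.disjoint_of_subset_right Finset.subset_union_right hu)
  have h3 : finNorm u (x + y) < √ε := by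
    have := finNorm_add_le u x y
    linarith
  exact (Real.sqrt_lt_sqrt_iff (norm_nonneg _)).1 h3

theorem polarization {A : Type*} [CStarAlgebra A] (a b : A) : star a * b = (1 / 2 : ℂ) •
    ((star (a + b) * (a + b) - star a * a - star b * b)
      - Complex.I • (star (a + Complex.I • b) * (a + Complex.I • b)
        - star a * a - star b * b)) := by
  have e1 : star (a + b) * (a + b) - star a * a - star b * b = star a * b + star b * a := by
    simp only [star_add, add_mul, mul_add]; abel
  have e2 : star (a + Complex.I • b) * (a + Complex.I • b) - star a * a - star b * b
      = Complex.I • (star a * b) - Complex.I • (star b * a) := by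
    have h : star Complex.I * Complex.I = 1 := by simp
    simp only [star_add, star_smul, add_mul, mul_add, smul_mul_assoc, mul_smul_comm]
    rw [smul_add, smul_smul, mul_comm Complex.I (star Complex.I), h, one_smul,
      show star Complex.I = -Complex.I by simp, neg_smul]
    abel
  have e3 : Complex.I • (Complex.I • (star a * b) - Complex.I • (star b * a))
      = star b * a - star a * b := by
    rw [smul_sub, smul_smul, smul_smul, Complex.I_mul_I, neg_smul, neg_smul, one_smul, one_smul]
    abel
  rw [e1, e2, e3]
  module

/-- The sequences `ξ` in `A` for which `∑ ξ_j* ξ_j` converges in norm, as a right `A`-module.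
(The terms are positive, so unconditional convergence, which is what `Summable` says, is the same
as convergence of the partial sums.) -/
def stdSubmodule (A : Type*) [CStarAlgebra A] [PartialOrder A] [StarOrderedRing A] :
    Submodule Aᵐᵒᵖ (ℕ → A) where
  carrier := {x | Summable fun j => star (x j) * x j}
  add_mem' hx hy := summable_add hx hy
  zero_mem' := by simp
  smul_mem' a x hx := by
    have := (Summable.mul_left (star a.unop) hx).mul_right a.unop
    simpa [mul_assoc] using this

/-- The standard Hilbert module `H_A`. -/
def StdModule (A : Type*) [CStarAlgebra A] [PartialOrder A] [StarOrderedRing A] : Type _ :=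
  stdSubmodule A

variable {A : Type*} [CStarAlgebra A] [PartialOrder A] [StarOrderedRing A]

instance : AddCommGroup (StdModule A) := inferInstanceAs (AddCommGroup (stdSubmodule A))

/-- The right action of `A` on `H_A`, `(ξ_j) a = (ξ_j a)`. -/
instance : Module Aᵐᵒᵖ (StdModule A) := inferInstanceAs (Module Aᵐᵒᵖ (stdSubmodule A))

instance : Module ℂ (StdModule A) := inferInstanceAs (Module ℂ (stdSubmodule A))

/-- The coordinates `ξ_j` of an element of `H_A`. -/
def StdModule.coord (x : StdModule A) : ℕ → A := Subtype.val (p := (· ∈ stdSubmodule A)) x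

instance : CoeFun (StdModule A) (fun _ => ℕ → A) := ⟨StdModule.coord⟩

theorem StdModule.ext {x y : StdModule A} (h : ∀ j, x j = y j) : x = y :=
  Subtype.ext (funext h)

theorem StdModule.zero_apply (j : ℕ) : (0 : StdModule A) j = 0 := rfl

theorem StdModule.add_apply (x y : StdModule A) (j : ℕ) : (x + y) j = x j + y j := rfl

theorem StdModule.smul_apply (c : ℂ) (x : StdModule A) (j : ℕ) : (c • x) j = c • x j := rfl

theorem StdModule.op_smul_apply (a : A) (x : StdModule A) (j : ℕ) :
    (MulOpposite.op a • x) j = x j * a := rfl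

theorem StdModule.summable (x : StdModule A) : Summable fun j => star (x j) * x j := x.2

/-- The `A`-valued inner product `⟨x, y⟩ = ∑_j ξ_j* η_j`. -/
def ip (x y : StdModule A) : A := ∑' j, star (x j) * y j

/-- The series that defines the inner product converges. -/
theorem ip_summable (x y : StdModule A) : Summable fun j => star (x j) * y j := by
  have h1 := (x + y).summable
  have h2 := (x + Complex.I • y).summable
  simp only [StdModule.add_apply, StdModule.smul_apply] at h1 h2
  simp_rw [fun j => polarization (x j) (y j)]
  exact (((h1.sub x.summable).sub y.summable).sub
    (((h2.sub x.summable).sub y.summable).const_smul _)).const_smul _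

/-- The Hilbert module norm `‖x‖ = ‖⟨x, x⟩‖^{1/2}`. -/
instance : Norm (StdModule A) := ⟨fun x => √‖ip x x‖⟩

theorem norm_def (x : StdModule A) : ‖x‖ = √‖ip x x‖ := rfl

theorem tendsto_finNorm (x : StdModule A) :
    Filter.Tendsto (fun s => finNorm s x) Filter.atTop (nhds ‖x‖) :=
  (Real.continuous_sqrt.tendsto _).comp
    ((continuous_norm.tendsto _).comp x.summable.hasSum)

theorem finNorm_le_norm (s : Finset ℕ) (x : StdModule A) : finNorm s x ≤ ‖x‖ :=
  ge_of_tendsto (tendsto_finNorm x)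
    (Filter.eventually_atTop.2 ⟨s, fun _ ht => finNorm_le_of_subset ht x⟩)

theorem normCore : NormedSpace.Core ℂ (StdModule A) where
  norm_nonneg _ := Real.sqrt_nonneg _
  norm_smul c x := by
    have h : ip (c • x) (c • x) = (star c * c) • ip x x := by
      rw [ip, ip, ← tsum_const_smul'']
      refine tsum_congr fun j => ?_
      rw [StdModule.smul_apply, star_smul, smul_mul_assoc, mul_smul_comm, smul_smul]
    rw [norm_def, norm_def, h, norm_smul, norm_mul, norm_star,
      Real.sqrt_mul (by positivity), Real.sqrt_mul_self (norm_nonneg _)]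
  norm_triangle x y :=
    le_of_tendsto_of_tendsto' (tendsto_finNorm (x + y))
      ((tendsto_finNorm x).add (tendsto_finNorm y)) fun s => finNorm_add_le s x y
  norm_eq_zero_iff x := by
    constructor
    · intro h
      refine StdModule.ext fun j => ?_
      have h1 := finNorm_le_norm {j} x
      rw [h, finNorm, Finset.sum_singleton, CStarRing.norm_star_mul_self,
        Real.sqrt_mul_self (norm_nonneg _)] at h1
      exact norm_le_zero_iff.1 h1
    · rintro rfl
      have : ip (0 : StdModule A) 0 = 0 := by
        simp [ip, StdModule.zero_apply]
      rw [norm_def, this, norm_zero, Real.sqrt_zero]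

instance : NormedAddCommGroup (StdModule A) := NormedAddCommGroup.ofCore normCore

instance : NormedSpace ℂ (StdModule A) := NormedSpace.ofCore normCore

end StandardModule

section Operators

/-! ### Adjointable and compact operators -/

variable {A : Type*} [CStarAlgebra A] [PartialOrder A] [StarOrderedRing A]

/-- `T ∈ B^a(H_A)`: the bounded operator `T` is `A`-linear and has a bounded adjoint. -/
def IsAdjointable (T : StdModule A →L[ℂ] StdModule A) : Prop :=
  (∀ (a : A) (x : StdModule A), T (MulOpposite.op a • x) = MulOpposite.op a • T x) ∧
  ∃ S : StdModule A →L[ℂ] StdModule A, ∀ x y, ip (T x) y = ip x (S y)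

/-- Finite rank operators: finite sums of the operators `Θ_{y,z} x = y ⟨z, x⟩`.
(Coefficients are absorbed in the vectors `y`.) -/
def IsFiniteRank (F : StdModule A →L[ℂ] StdModule A) : Prop :=
  ∃ (n : ℕ) (y z : Fin n → StdModule A),
    ∀ x, F x = ∑ i, MulOpposite.op (ip (z i) x) • y i

/-- `A`-compact operators: the norm closure of the finite rank operators. -/
def IsACompact (K : StdModule A →L[ℂ] StdModule A) : Prop :=
  K ∈ closure {F : StdModule A →L[ℂ] StdModule A | IsFiniteRank F}

end Operators

section Pseudometric

/-! ### Measures of noncompactness for a single pseudometric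

The values are in `[0, ∞]`; the infimum of the empty set is `∞`, the supremum is `0`. -/

variable {X : Type*}

/-- The Hausdorff measure of noncompactness; the centres may lie anywhere in `X`. -/
def hausdorff (d : X → X → ℝ) (E : Set X) : ℝ≥0∞ :=
  sInf (ENNReal.ofReal '' {ε : ℝ | 0 < ε ∧
    ∃ F : Set X, F.Finite ∧ E ⊆ ⋃ x ∈ F, {y | d x y < ε}})

/-- The diameter of a set. -/
def diam (d : X → X → ℝ) (S : Set X) : ℝ≥0∞ :=
  ⨆ x ∈ S, ⨆ y ∈ S, ENNReal.ofReal (d x y)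

/-- The Kuratowski measure of noncompactness. -/
def kuratowski (d : X → X → ℝ) (E : Set X) : ℝ≥0∞ :=
  sInf (ENNReal.ofReal '' {ε : ℝ | 0 < ε ∧
    ∃ C : Set (Set X), C.Finite ∧ E = ⋃₀ C ∧ ∀ S ∈ C, diam d S < ENNReal.ofReal ε})

/-- The Istratescu measure of noncompactness. -/
def istratescu (d : X → X → ℝ) (E : Set X) : ℝ≥0∞ :=
  sSup (ENNReal.ofReal '' {ε : ℝ | 0 < ε ∧
    ∃ S : Set X, S ⊆ E ∧ S.Infinite ∧ ∀ x ∈ S, ∀ y ∈ S, x ≠ y → ε ≤ d x y})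

end Pseudometric

section Troitsky

/-! ### Troitsky's seminorms and the measures of noncompactness they give -/

/-- States of the unital `C*`-algebra `A`: positive functionals `φ` with `φ(1) = 1`. -/
def State (A : Type*) [CStarAlgebra A] [PartialOrder A] : Type _ :=
  {φ : A →ₚ[ℂ] ℂ // φ 1 = 1}

variable {A : Type*} [CStarAlgebra A] [PartialOrder A] [StarOrderedRing A]

/-- A sequence `(x_i)` in `H_A` is admissible: for all `x` the series
`∑ ⟨x, x_i⟩⟨x_i, x⟩` converges in norm, its sum is at most `⟨x, x⟩`, and `‖x_i‖ ≤ 1`.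
(Finite systems are covered by adding zero vectors.) -/
structure Admissible (X : ℕ → StdModule A) : Prop where
  summable : ∀ x, Summable fun i => ip x (X i) * ip (X i) x
  tsum_le : ∀ x, ∑' i, ip x (X i) * ip (X i) x ≤ ip x x
  norm_le : ∀ i, ‖X i‖ ≤ 1

/-- `p_{X,Φ}(x) = (sup_k ∑_{i ≥ k} |φ_k(⟨x, x_i⟩)|²)^{1/2}`. -/
def troitskySeminorm (X : ℕ → StdModule A) (Φ : ℕ → State A) (x : StdModule A) : ℝ :=
  √(⨆ k, ∑' i, ‖(Φ k).1 (ip x (X (k + i)))‖ ^ 2)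

/-- The pseudometric of the seminorm `p_{X,Φ}`. -/
def troitskyDist (X : ℕ → StdModule A) (Φ : ℕ → State A) (x y : StdModule A) : ℝ :=
  troitskySeminorm X Φ (x - y)

/-- `μ*(E)`, the supremum of `μ_d(E)` over the pseudometrics `d` that define Troitsky's
topology, for a measure of noncompactness `μ` for pseudometrics. -/
def starMNC (μ : (StdModule A → StdModule A → ℝ) → Set (StdModule A) → ℝ≥0∞)
    (E : Set (StdModule A)) : ℝ≥0∞ :=
  ⨆ (X : ℕ → StdModule A) (_ : Admissible X) (Φ : ℕ → State A), μ (troitskyDist X Φ) E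

/-- Finitely generated projective (closed) submodules of `H_A`. -/
structure IsFGProjective (L : Submodule Aᵐᵒᵖ (StdModule A)) : Prop where
  closed : IsClosed (L : Set (StdModule A))
  finite : Module.Finite Aᵐᵒᵖ L
  projective : Module.Projective Aᵐᵒᵖ L

/-- `λ(E) = inf_L sup_{x ∈ E} d(x, L)` over the finitely generated projective submodules. -/
def lambdaMNC (E : Set (StdModule A)) : ℝ≥0∞ :=
  ⨅ (L : Submodule Aᵐᵒᵖ (StdModule A)) (_ : IsFGProjective L),
    ⨆ x ∈ E, Metric.infEDist x (L : Set (StdModule A))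

/-! ### Measures of noncompactness of operators -/

/-- The image `T(B_1)` of the closed unit ball. -/
def imageBall (T : StdModule A →L[ℂ] StdModule A) : Set (StdModule A) :=
  T '' Metric.closedBall 0 1

/-- `χ_o*(T) = χ*(T(B_1))`. -/
def chiOp (T : StdModule A →L[ℂ] StdModule A) : ℝ≥0∞ := starMNC hausdorff (imageBall T)

/-- `α_o*(T) = α*(T(B_1))`. -/
def alphaOp (T : StdModule A →L[ℂ] StdModule A) : ℝ≥0∞ := starMNC kuratowski (imageBall T)

/-- `I_o*(T) = I*(T(B_1))`. -/
def istrOp (T : StdModule A →L[ℂ] StdModule A) : ℝ≥0∞ := starMNC istratescu (imageBall T)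

/-- `λ_o(T) = λ(T(B_1))`. -/
def lambdaOp (T : StdModule A →L[ℂ] StdModule A) : ℝ≥0∞ := lambdaMNC (imageBall T)

end Troitsky

end

end HilbertMNC

/-!
For a single pseudometric that comes from a seminorm, `χ ≤ I ≤ α ≤ 2 χ`, and each of the three
measures is monotone, positively homogeneous and subadditive; only the subadditivity of the
Istratescu measure is not immediate, it uses Ramsey's theorem for pairs
(`exists_infinite_homogeneous`). These facts pass to the suprema over all pseudometrics of
Troitsky, so everything reduces to `χ_o*(T) = λ_o(T)` (`chiOp_eq_lambdaOp`), and to the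
description of compactness by tails. Let `Q_n = restr (Set.Ici n)` be the projection onto the
coordinates from the `n`-th on.

For an admissible sequence `X` the analysis operator `θ x = (⟨x_i, x⟩)_i` is an `A`-linear
contraction of `H_A`, and `p_{X,Φ}(x)` is the value at `θ x` of a seminorm (`stateSeminorm`) that
is at most the norm. If `L` is a closed finitely generated submodule, the open mapping theorem
gives bounded coefficients for the elements of a bounded part of `L`, so `‖Q_m θ z‖` is uniformly
small there; what remains are finitely many functionals `φ_k(⟨x_i, ·⟩)`. Hence bounded parts of
`L` are totally bounded for `p_{X,Φ}` (`Admissible.exists_finite_net`), and `χ* ≤ λ` on bounded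
sets.

Conversely, `λ_o(T) ≤ ‖Q_n T‖` for all `n`, because the kernel of `Q_n` is free of rank `n`. If
`‖Q_n T‖ > c` for all `n`, a gliding hump argument gives vectors `x_i` of the unit ball and
disjoint blocks `y_i` of `T x_i` with `‖y_i‖ > c`. The normalized blocks are admissible by the
Cauchy–Schwarz inequality; with states that attain the norms of `⟨y_i, y_i⟩` they define a
pseudometric for which finitely many balls of radius less than `c` do not cover `T(B_1)`
(`ofReal_le_chiOp`). Thus `λ_o(T) ≤ χ_o*(T)`, and `λ_o(T) = 0` forces `‖Q_n T‖` to come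
arbitrarily close to `0`. Since `(1 - Q_n) T` has finite rank if `T` has an adjoint, `T` is then
`A`-compact.
-/

namespace HilbertMNC

open scoped Pointwise
open Filter Topology

/-! ### Ramsey's theorem for pairs -/

/-- If `r x y` holds for almost all `x` and, given `x`, for almost all `y`, then an infinite
`r`-homogeneous set can be chosen point by point. -/
theorem exists_infinite_pairwise_of_eventually {α : Type*} {l : Filter α} [l.NeBot]
    (hl : l ≤ cofinite) {S : Set α} (hS : S ∈ l) {r : α → α → Prop}
    (symm : ∀ x y, r x y → r y x) (h : ∀ᶠ x in l, ∀ᶠ y in l, r x y) :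
    ∃ T ⊆ S, T.Infinite ∧ T.Pairwise r := by
  have : Std.Symm (fun x y => r x y ∧ x ≠ y) := ⟨fun x y h => ⟨symm _ _ h.1, h.2.symm⟩⟩
  obtain ⟨f, hf, hr⟩ := exists_seq_of_forall_finset_exists'
    (fun x => x ∈ S ∧ ∀ᶠ y in l, r x y) (fun x y => r x y ∧ x ≠ y) (fun s hs => by
      have h1 : ∀ᶠ y in l, ∀ x ∈ s, r x y := by
        rw [eventually_all_finset]
        exact fun x hx => (hs x hx).2
      have h2 : ∀ᶠ y in l, y ∉ s := hl s.finite_toSet.compl_mem_cofinite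
      obtain ⟨y, h1, h2, h3, h4⟩ := (h1.and (h2.and (h.and hS))).exists
      exact ⟨y, ⟨h4, h3⟩, fun x hx => ⟨h1 x hx, fun e => h2 (e ▸ hx)⟩⟩)
  have inj : Function.Injective f := fun m n e => by
    by_contra hne
    exact (hr hne).2 e
  refine ⟨Set.range f, Set.range_subset_iff.2 fun n => (hf n).1,
    Set.infinite_range_of_injective inj, ?_⟩
  rintro _ ⟨m, rfl⟩ _ ⟨n, rfl⟩ hne
  exact (hr fun e : m = n => hne (by rw [e])).1

/-- An ultrafilter that is finer than the cofinite filter of `S` decides the colour. -/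
theorem exists_infinite_homogeneous {α : Type*} {S : Set α} (hS : S.Infinite)
    {r : α → α → Prop} (symm : ∀ x y, r x y → r y x) :
    ∃ T ⊆ S, T.Infinite ∧ (T.Pairwise r ∨ T.Pairwise fun x y => ¬ r x y) := by
  have : (cofinite ⊓ 𝓟 S).NeBot := hS.cofinite_inf_principal_neBot
  let U := Ultrafilter.of (cofinite ⊓ 𝓟 S)
  have hU : (U : Filter α) ≤ cofinite ⊓ 𝓟 S := Ultrafilter.of_le _
  have hUc : (U : Filter α) ≤ cofinite := hU.trans inf_le_left
  have hUS : S ∈ (U : Filter α) := le_principal_iff.1 (hU.trans inf_le_right)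
  rcases U.em (fun x => ∀ᶠ y in (U : Filter α), r x y) with h | h
  · obtain ⟨T, h1, h2, h3⟩ := exists_infinite_pairwise_of_eventually hUc hUS symm h
    exact ⟨T, h1, h2, Or.inl h3⟩
  · simp only [← Ultrafilter.eventually_not] at h
    obtain ⟨T, h1, h2, h3⟩ := exists_infinite_pairwise_of_eventually hUc hUS
      (r := fun x y => ¬ r x y) (fun x y h h' => h (symm _ _ h')) h
    exact ⟨T, h1, h2, Or.inr h3⟩

/-! ### Measures of noncompactness of the pseudometric of a seminorm -/

theorem diam_le {X : Type*} {d : X → X → ℝ} {S : Set X} {c : ℝ}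
    (h : ∀ x ∈ S, ∀ y ∈ S, d x y ≤ c) : diam d S ≤ ENNReal.ofReal c :=
  iSup₂_le fun x hx => iSup₂_le fun y hy => ENNReal.ofReal_le_ofReal (h x hx y hy)

theorem lt_of_diam_lt {X : Type*} {d : X → X → ℝ} {S : Set X} {c : ℝ}
    (h : diam d S < ENNReal.ofReal c) {x y : X} (hx : x ∈ S) (hy : y ∈ S) : d x y < c := by
  have h1 : ENNReal.ofReal (d x y) ≤ diam d S :=
    (le_iSup₂ (f := fun y (_ : y ∈ S) => ENNReal.ofReal (d x y)) y hy).trans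
      (le_iSup₂ (f := fun x (_ : x ∈ S) => ⨆ y ∈ S, ENNReal.ofReal (d x y)) x hx)
  exact (ENNReal.ofReal_lt_ofReal_iff'.1 (h1.trans_lt h)).1

section Seminorm

variable {V : Type*} [AddCommGroup V] [Module ℂ V] (p : Seminorm ℂ V)

theorem hausdorff_mono {E F : Set V} (h : E ⊆ F) :
    hausdorff (fun x y => p (x - y)) E ≤ hausdorff (fun x y => p (x - y)) F := by
  refine sInf_le_sInf (Set.image_mono ?_)
  rintro ε ⟨hε, C, hC, hF⟩
  exact ⟨hε, C, hC, h.trans hF⟩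

theorem kuratowski_mono {E F : Set V} (h : E ⊆ F) :
    kuratowski (fun x y => p (x - y)) E ≤ kuratowski (fun x y => p (x - y)) F := by
  refine sInf_le_sInf (Set.image_mono ?_)
  rintro ε ⟨hε, C, hC, hF, hd⟩
  refine ⟨hε, (fun S => S ∩ E) '' C, hC.image _, ?_, ?_⟩
  · rw [Set.sUnion_image, ← Set.iUnion₂_inter, ← Set.sUnion_eq_biUnion, ← hF]
    exact (Set.inter_eq_right.2 h).symm
  · rintro _ ⟨S, hS, rfl⟩
    refine lt_of_le_of_lt ?_ (hd S hS)
    exact (biSup_mono fun x hx => hx.1).trans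
      (iSup₂_mono fun x _ => biSup_mono fun y hy => hy.1)

theorem istratescu_mono {E F : Set V} (h : E ⊆ F) :
    istratescu (fun x y => p (x - y)) E ≤ istratescu (fun x y => p (x - y)) F := by
  refine sSup_le_sSup (Set.image_mono ?_)
  rintro ε ⟨hε, S, hS, hF⟩
  exact ⟨hε, S, hS.trans h, hF⟩

theorem hausdorff_add_le (E F : Set V) :
    hausdorff (fun x y => p (x - y)) (E + F) ≤
      hausdorff (fun x y => p (x - y)) E + hausdorff (fun x y => p (x - y)) F := by
  conv_rhs => rw [hausdorff, hausdorff, ENNReal.sInf_add]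
  refine le_iInf₂ ?_
  rintro _ ⟨ε, ⟨hε, C, hC, hE⟩, rfl⟩
  rw [ENNReal.add_sInf]
  refine le_iInf₂ ?_
  rintro _ ⟨δ, ⟨hδ, D, hD, hF⟩, rfl⟩
  rw [← ENNReal.ofReal_add hε.le hδ.le]
  refine sInf_le ⟨ε + δ, ⟨by positivity, C + D, hC.add hD, ?_⟩, rfl⟩
  rintro _ ⟨x, hx, y, hy, rfl⟩
  obtain ⟨c, hc, hxc⟩ := Set.mem_iUnion₂.1 (hE hx)
  obtain ⟨e, he, hye⟩ := Set.mem_iUnion₂.1 (hF hy)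
  refine Set.mem_iUnion₂.2 ⟨c + e, Set.add_mem_add hc he, ?_⟩
  simp only [Set.mem_ofPred_eq] at hxc hye ⊢
  rw [add_sub_add_comm]
  exact (map_add_le_add p _ _).trans_lt (add_lt_add hxc hye)

theorem kuratowski_add_le (E F : Set V) :
    kuratowski (fun x y => p (x - y)) (E + F) ≤
      kuratowski (fun x y => p (x - y)) E + kuratowski (fun x y => p (x - y)) F := by
  conv_rhs => rw [kuratowski, kuratowski, ENNReal.sInf_add]
  refine le_iInf₂ ?_
  rintro _ ⟨ε, ⟨hε, C, hC, hE, hCd⟩, rfl⟩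
  rw [ENNReal.add_sInf]
  refine le_iInf₂ ?_
  rintro _ ⟨δ, ⟨hδ, D, hD, hF, hDd⟩, rfl⟩
  rw [← ENNReal.ofReal_add hε.le hδ.le]
  refine sInf_le ⟨ε + δ, ⟨by positivity, Set.image2 (· + ·) C D, hC.image2 _ hD, ?_, ?_⟩, rfl⟩
  · ext z
    constructor
    · rintro ⟨x, hx, y, hy, rfl⟩
      rw [hE] at hx
      rw [hF] at hy
      obtain ⟨S, hS, hx⟩ := hx
      obtain ⟨T, hT, hy⟩ := hy
      exact ⟨S + T, ⟨S, hS, T, hT, rfl⟩, Set.add_mem_add hx hy⟩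
    · rintro ⟨_, ⟨S, hS, T, hT, rfl⟩, x, hx, y, hy, rfl⟩
      exact Set.add_mem_add (hE ▸ ⟨S, hS, hx⟩) (hF ▸ ⟨T, hT, hy⟩)
  · rintro _ ⟨S, hS, T, hT, rfl⟩
    rw [ENNReal.ofReal_add hε.le hδ.le]
    refine lt_of_le_of_lt ?_ (ENNReal.add_lt_add (hCd S hS) (hDd T hT))
    refine iSup₂_le fun z hz => iSup₂_le fun w hw => ?_
    obtain ⟨x, hx, y, hy, rfl⟩ := hz
    obtain ⟨x', hx', y', hy', rfl⟩ := hw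
    have h1 : ENNReal.ofReal (p (x - x')) ≤ diam (fun x y => p (x - y)) S :=
      (le_iSup₂ (f := fun y (_ : y ∈ S) => ENNReal.ofReal (p (x - y))) x' hx').trans
        (le_iSup₂ (f := fun x (_ : x ∈ S) => ⨆ y ∈ S, ENNReal.ofReal (p (x - y))) x hx)
    have h2 : ENNReal.ofReal (p (y - y')) ≤ diam (fun x y => p (x - y)) T :=
      (le_iSup₂ (f := fun z (_ : z ∈ T) => ENNReal.ofReal (p (y - z))) y' hy').trans
        (le_iSup₂ (f := fun x (_ : x ∈ T) => ⨆ y ∈ T, ENNReal.ofReal (p (x - y))) y hy)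
    refine le_trans ?_ (add_le_add h1 h2)
    rw [← ENNReal.ofReal_add (apply_nonneg _ _) (apply_nonneg _ _)]
    refine ENNReal.ofReal_le_ofReal ?_
    simp only [add_sub_add_comm]
    exact map_add_le_add p _ _

/-- The form of an upper bound for the Istratescu measure that is used below: a family of points
that is separated by more than the measure has only finitely many members. -/
theorem finite_of_istratescu_lt {E : Set V} {a : ℝ} (ha : 0 < a)
    (h : istratescu (fun x y => p (x - y)) E < ENNReal.ofReal a) {ι : Type*} {T : Set ι}
    {f : ι → V} (hf : ∀ i ∈ T, f i ∈ E)
    (hT : T.Pairwise fun i j => a ≤ p (f i - f j)) : T.Finite := by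
  by_contra hinf
  have inj : Set.InjOn f T := by
    intro i hi j hj e
    by_contra hne
    have : a ≤ p (f i - f j) := hT hi hj hne
    rw [e, sub_self, map_zero] at this
    exact absurd this (not_le.2 ha)
  refine absurd h (not_lt.2 (le_sSup ⟨a, ⟨ha, f '' T, ?_, ?_, ?_⟩, rfl⟩))
  · rintro _ ⟨i, hi, rfl⟩
    exact hf i hi
  · exact Set.Infinite.image inj hinf
  · rintro _ ⟨i, hi, rfl⟩ _ ⟨j, hj, rfl⟩ hne
    exact hT hi hj fun e => hne (e ▸ rfl)

/-- If a sum `s = e + f` is separated by `a + b`, then any two `e`'s are `a`-separated or the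
corresponding `f`'s are `b`-separated; Ramsey's theorem makes the choice uniform. -/
theorem istratescu_add_le (E F : Set V) :
    istratescu (fun x y => p (x - y)) (E + F) ≤
      istratescu (fun x y => p (x - y)) E + istratescu (fun x y => p (x - y)) F := by
  refine sSup_le ?_
  rintro _ ⟨ε, ⟨hε, S, hSE, hS, hd⟩, rfl⟩
  by_contra! hlt
  set u := istratescu (fun x y => p (x - y)) E
  set v := istratescu (fun x y => p (x - y)) F
  have huv : u + v ≠ ∞ := (hlt.trans ENNReal.ofReal_lt_top).ne
  have hu : u ≠ ∞ := fun h => huv (by simp [h])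
  have hv : v ≠ ∞ := fun h => huv (by simp [h])
  have hlt' : u.toReal + v.toReal < ε := by
    rw [← ENNReal.toReal_add hu hv]
    exact (ENNReal.lt_ofReal_iff_toReal_lt huv).1 hlt
  have hu0 : 0 ≤ u.toReal := ENNReal.toReal_nonneg
  have hv0 : 0 ≤ v.toReal := ENNReal.toReal_nonneg
  obtain ⟨a, ha, b, hb, hab⟩ : ∃ a, u.toReal < a ∧ ∃ b, v.toReal < b ∧ a + b = ε :=
    ⟨u.toReal + (ε - u.toReal - v.toReal) / 2, by linarith,
      v.toReal + (ε - u.toReal - v.toReal) / 2, by linarith, by ring⟩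
  have hsum : ∀ s : V, ∃ e f : V, s ∈ S → e ∈ E ∧ f ∈ F ∧ e + f = s := by
    intro s
    by_cases hs : s ∈ S
    · obtain ⟨e, he, f, hf, hef⟩ := hSE hs
      exact ⟨e, f, fun _ => ⟨he, hf, hef⟩⟩
    · exact ⟨0, 0, fun h => absurd h hs⟩
  choose e f hef using hsum
  obtain ⟨T, hTS, hTinf, hT⟩ := exists_infinite_homogeneous hS
    (r := fun x y => a ≤ p (e x - e y)) fun x y h => by rwa [map_sub_rev]
  rcases hT with hT | hT
  · refine hTinf (finite_of_istratescu_lt p (hu0.trans_lt ha) (E := E)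
      ((ENNReal.lt_ofReal_iff_toReal_lt hu).2 ha) (f := e) (fun i hi => ?_) hT)
    exact (hef i (hTS hi)).1
  · refine hTinf (finite_of_istratescu_lt p (hv0.trans_lt hb) (E := F)
      ((ENNReal.lt_ofReal_iff_toReal_lt hv).2 hb) (f := f)
      (fun i hi => (hef i (hTS hi)).2.1) ?_)
    intro i hi j hj hne
    have h1 := hT hi hj hne
    have h2 : ε ≤ p (i - j) := hd i (hTS hi) j (hTS hj) hne
    have h3 : i - j = (e i - e j) + (f i - f j) := by
      rw [← add_sub_add_comm, (hef i (hTS hi)).2.2, (hef j (hTS hj)).2.2]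
    rw [h3] at h2
    have h4 := map_add_le_add p (e i - e j) (f i - f j)
    simp only [not_le] at h1
    linarith

theorem hausdorff_smul_le {c : ℝ} (hc : 0 < c) (E : Set V) :
    hausdorff (fun x y => p (x - y)) ((c : ℂ) • E) ≤
      ENNReal.ofReal c * hausdorff (fun x y => p (x - y)) E := by
  have hc' : ENNReal.ofReal c ≠ 0 := by simpa using hc
  conv_rhs => rw [hausdorff, sInf_image, ENNReal.mul_iInf_of_ne hc' ENNReal.ofReal_ne_top]
  refine le_iInf fun ε => ?_
  rw [ENNReal.mul_iInf_of_ne hc' ENNReal.ofReal_ne_top]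
  refine le_iInf ?_
  rintro ⟨hε, C, hC, hE⟩
  rw [← ENNReal.ofReal_mul hc.le]
  refine sInf_le ⟨c * ε, ⟨by positivity, (c : ℂ) • C, hC.smul_set, ?_⟩, rfl⟩
  rintro _ ⟨x, hx, rfl⟩
  obtain ⟨z, hz, hxz⟩ := Set.mem_iUnion₂.1 (hE hx)
  refine Set.mem_iUnion₂.2 ⟨(c : ℂ) • z, Set.smul_mem_smul_set hz, ?_⟩
  simp only [Set.mem_ofPred_eq] at hxz ⊢
  rw [← smul_sub, map_smul_eq_mul, Complex.norm_of_nonneg hc.le]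
  gcongr

theorem kuratowski_smul_le {c : ℝ} (hc : 0 < c) (E : Set V) :
    kuratowski (fun x y => p (x - y)) ((c : ℂ) • E) ≤
      ENNReal.ofReal c * kuratowski (fun x y => p (x - y)) E := by
  have hc' : ENNReal.ofReal c ≠ 0 := by simpa using hc
  conv_rhs => rw [kuratowski, sInf_image, ENNReal.mul_iInf_of_ne hc' ENNReal.ofReal_ne_top]
  refine le_iInf fun ε => ?_
  rw [ENNReal.mul_iInf_of_ne hc' ENNReal.ofReal_ne_top]
  refine le_iInf ?_
  rintro ⟨hε, C, hC, hE, hd⟩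
  rw [← ENNReal.ofReal_mul hc.le]
  refine sInf_le ⟨c * ε, ⟨by positivity, (fun S => (c : ℂ) • S) '' C, hC.image _, ?_, ?_⟩, rfl⟩
  · rw [hE, Set.sUnion_image, Set.sUnion_eq_biUnion, Set.smul_set_iUnion₂]
  · rintro _ ⟨S, hS, rfl⟩
    rw [ENNReal.ofReal_mul hc.le]
    refine lt_of_le_of_lt ?_ (ENNReal.mul_lt_mul_right hc' ENNReal.ofReal_ne_top (hd S hS))
    refine iSup₂_le fun x hx => iSup₂_le fun y hy => ?_
    obtain ⟨x, hx, rfl⟩ := hx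
    obtain ⟨y, hy, rfl⟩ := hy
    simp only [← smul_sub, map_smul_eq_mul, Complex.norm_of_nonneg hc.le]
    rw [ENNReal.ofReal_mul hc.le]
    gcongr
    exact (le_iSup₂ (f := fun y (_ : y ∈ S) => ENNReal.ofReal (p (x - y))) y hy).trans
        (le_iSup₂ (f := fun x (_ : x ∈ S) => ⨆ y ∈ S, ENNReal.ofReal (p (x - y))) x hx)

theorem istratescu_smul_le {c : ℝ} (hc : 0 < c) (E : Set V) :
    istratescu (fun x y => p (x - y)) ((c : ℂ) • E) ≤
      ENNReal.ofReal c * istratescu (fun x y => p (x - y)) E := by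
  refine sSup_le ?_
  rintro _ ⟨ε, ⟨hε, S, hSE, hS, hd⟩, rfl⟩
  have hc0 : (c : ℂ) ≠ 0 := by exact_mod_cast hc.ne'
  have h : ENNReal.ofReal (c⁻¹ * ε) ≤ istratescu (fun x y => p (x - y)) E := by
    refine le_sSup ⟨c⁻¹ * ε, ⟨by positivity, (c : ℂ)⁻¹ • S, ?_, ?_, ?_⟩, rfl⟩
    · rwa [← Set.subset_smul_set_iff₀ hc0]
    · exact hS.image (smul_right_injective V (inv_ne_zero hc0)).injOn
    · rintro _ ⟨x, hx, rfl⟩ _ ⟨y, hy, rfl⟩ hne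
      simp only [← smul_sub, map_smul_eq_mul, norm_inv, Complex.norm_of_nonneg hc.le]
      gcongr
      exact hd x hx y hy fun e => hne (e ▸ rfl)
  calc ENNReal.ofReal ε = ENNReal.ofReal c * ENNReal.ofReal (c⁻¹ * ε) := by
        rw [← ENNReal.ofReal_mul hc.le, mul_inv_cancel_left₀ hc.ne']
    _ ≤ _ := by gcongr

/-- If `χ(E)` is larger than `ε`, an `ε`-separated sequence in `E` can be chosen greedily. -/
theorem hausdorff_le_istratescu (E : Set V) :
    hausdorff (fun x y => p (x - y)) E ≤ istratescu (fun x y => p (x - y)) E := by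
  refine le_of_forall_lt fun c hc => ?_
  obtain ⟨ε, hcε, hε⟩ := ENNReal.lt_iff_exists_nnreal_btwn.1 hc
  refine hcε.trans_le ?_
  rcases eq_or_lt_of_le (zero_le (a := ε)) with h0 | hε0
  · simp [← h0]
  have hε0' : (0 : ℝ) < ε := hε0
  have : Std.Symm (fun x y : V => (ε : ℝ) ≤ p (x - y)) := ⟨fun x y h => by rwa [map_sub_rev]⟩
  obtain ⟨f, hf, hr⟩ := exists_seq_of_forall_finset_exists'
    (fun x => x ∈ E) (fun x y => (ε : ℝ) ≤ p (x - y)) (fun s hs => by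
      by_contra! hcon
      refine absurd hε (not_lt.2 ?_)
      refine sInf_le ⟨ε, ⟨hε0', s, s.finite_toSet, fun y hy => ?_⟩, by simp⟩
      obtain ⟨x, hx, hxy⟩ := hcon y hy
      exact Set.mem_iUnion₂.2 ⟨x, hx, hxy⟩)
  have inj : Function.Injective f := fun m n e => by
    by_contra hne
    have : (ε : ℝ) ≤ p (f m - f n) := hr hne
    rw [e, sub_self, map_zero] at this
    exact absurd this (not_le.2 hε0')
  refine le_sSup ⟨ε, ⟨hε0', Set.range f, Set.range_subset_iff.2 hf,
    Set.infinite_range_of_injective inj, ?_⟩, by simp⟩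
  rintro _ ⟨m, rfl⟩ _ ⟨n, rfl⟩ hne
  exact hr fun e : m = n => hne (by rw [e])

theorem istratescu_le_kuratowski (E : Set V) :
    istratescu (fun x y => p (x - y)) E ≤ kuratowski (fun x y => p (x - y)) E := by
  refine sSup_le ?_
  rintro _ ⟨ε, ⟨hε, S, hSE, hS, hd⟩, rfl⟩
  refine le_sInf ?_
  rintro _ ⟨δ, ⟨hδ, C, hC, hE, hCd⟩, rfl⟩
  refine ENNReal.ofReal_le_ofReal ?_
  by_contra! hlt
  refine hS ?_
  have hsub : S ⊆ ⋃ P ∈ C, S ∩ P := by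
    rw [← Set.inter_iUnion₂, ← Set.sUnion_eq_biUnion, ← hE]
    exact Set.subset_inter subset_rfl hSE
  refine (hC.biUnion fun P hP => Set.Subsingleton.finite ?_).subset hsub
  intro x hx y hy
  by_contra hne
  have h1 := hd x hx.1 y hy.1 hne
  have h2 := lt_of_diam_lt (hCd P hP) hx.2 hy.2
  linarith

theorem kuratowski_le_two_mul_hausdorff (E : Set V) :
    kuratowski (fun x y => p (x - y)) E ≤ 2 * hausdorff (fun x y => p (x - y)) E := by
  rw [hausdorff, sInf_image, ENNReal.mul_iInf_of_ne two_ne_zero ENNReal.ofNat_ne_top]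
  refine le_iInf fun ε => ?_
  rw [ENNReal.mul_iInf_of_ne two_ne_zero ENNReal.ofNat_ne_top]
  refine le_iInf ?_
  rintro ⟨hε, C, hC, hE⟩
  have h2 : (2 : ℝ≥0∞) * ENNReal.ofReal ε = ENNReal.ofReal (2 * ε) := by
    rw [ENNReal.ofReal_mul two_pos.le, ENNReal.ofReal_ofNat]
  rw [h2]
  -- balls of radius `ε` may have diameter exactly `2 ε`, but the diameters have to be strictly
  -- smaller than the number that is tested; hence the extra `η`
  refine ENNReal.le_of_forall_pos_le_add fun η hη _ => ?_
  rw [← ENNReal.ofReal_coe_nnreal, ← ENNReal.ofReal_add (p := 2 * ε) (by positivity) η.coe_nonneg]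
  refine sInf_le ⟨2 * ε + η, ⟨by positivity, (fun x => {y | p (x - y) < ε} ∩ E) '' C,
    hC.image _, ?_, ?_⟩, rfl⟩
  · rw [Set.sUnion_image, ← Set.iUnion₂_inter]
    exact (Set.inter_eq_right.2 hE).symm
  · rintro _ ⟨x, hx, rfl⟩
    refine (diam_le (c := 2 * ε) ?_).trans_lt
      ((ENNReal.ofReal_lt_ofReal_iff (by positivity)).2 (lt_add_of_pos_right _ hη))
    intro y hy z hz
    have h1 : p (x - y) < ε := hy.1
    have h2 : p (x - z) < ε := hz.1
    have h3 := map_add_le_add p (y - x) (x - z)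
    rw [sub_add_sub_cancel, map_sub_rev p y x] at h3
    linarith

end Seminorm

variable {A : Type*} [CStarAlgebra A] [PartialOrder A] [StarOrderedRing A]

/-! ### The inner product of the standard module -/

theorem StdModule.sub_apply (x y : StdModule A) (j : ℕ) : (x - y) j = x j - y j := rfl

theorem StdModule.sum_apply {ι : Type*} (s : Finset ι) (f : ι → StdModule A) (j : ℕ) :
    (∑ i ∈ s, f i) j = ∑ i ∈ s, f i j := by
  classical
  induction s using Finset.induction_on with
  | empty => rfl
  | insert a s ha ih => rw [Finset.sum_insert ha, Finset.sum_insert ha, StdModule.add_apply, ih]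

theorem ip_add_right (x y z : StdModule A) : ip x (y + z) = ip x y + ip x z := by
  simp only [ip, StdModule.add_apply, mul_add]
  exact (ip_summable x y).tsum_add (ip_summable x z)

theorem ip_sub_right (x y z : StdModule A) : ip x (y - z) = ip x y - ip x z := by
  simp only [ip, StdModule.sub_apply, mul_sub]
  exact (ip_summable x y).tsum_sub (ip_summable x z)

theorem ip_smul_right (c : ℂ) (x y : StdModule A) : ip x (c • y) = c • ip x y := by
  simp only [ip, StdModule.smul_apply, mul_smul_comm]
  exact tsum_const_smul'' c

theorem ip_op_smul_right (a : A) (x y : StdModule A) :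
    ip x (MulOpposite.op a • y) = ip x y * a := by
  simp only [ip, StdModule.op_smul_apply, ← mul_assoc]
  exact (ip_summable x y).tsum_mul_right a

theorem star_ip (x y : StdModule A) : star (ip x y) = ip y x := by
  simp only [ip, tsum_star, star_mul, star_star]

theorem ip_sub_left (x y z : StdModule A) : ip (x - y) z = ip x z - ip y z := by
  rw [← star_ip, ip_sub_right, star_sub, star_ip, star_ip]

theorem ip_smul_left (c : ℂ) (x y : StdModule A) : ip (c • x) y = star c • ip x y := by
  rw [← star_ip, ip_smul_right, star_smul, star_ip]

theorem ip_op_smul_left (a : A) (x y : StdModule A) :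
    ip (MulOpposite.op a • x) y = star a * ip x y := by
  rw [← star_ip, ip_op_smul_right, star_mul, star_ip]

theorem ip_self_nonneg (x : StdModule A) : 0 ≤ ip x x :=
  tsum_nonneg fun _ => star_mul_self_nonneg _

theorem norm_sq_eq (x : StdModule A) : ‖x‖ ^ 2 = ‖ip x x‖ :=
  Real.sq_sqrt (norm_nonneg _)

theorem norm_le_of_finNorm_le {x : StdModule A} {c : ℝ} (h : ∀ s, finNorm s x ≤ c) : ‖x‖ ≤ c :=
  le_of_tendsto' (tendsto_finNorm x) h

theorem norm_apply_le (x : StdModule A) (j : ℕ) : ‖x j‖ ≤ ‖x‖ := by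
  have h := finNorm_le_norm {j} x
  rwa [finNorm, Finset.sum_singleton, CStarRing.norm_star_mul_self,
    Real.sqrt_mul_self (norm_nonneg _)] at h

/-- The Cauchy–Schwarz inequality, in the order of `A`: expand `0 ≤ ⟨x - u a, x - u a⟩` for
`a = ⟨u, x⟩`. -/
theorem ip_mul_ip_le (x : StdModule A) {u : StdModule A} (hu : ‖u‖ ≤ 1) :
    ip x u * ip u x ≤ ip x x := by
  have h1 : ip u u ≤ 1 := by
    rw [← CStarAlgebra.norm_le_one_iff_of_nonneg _ (ip_self_nonneg u), ← norm_sq_eq]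
    exact pow_le_one₀ (norm_nonneg _) hu
  have h0 := ip_self_nonneg (x - MulOpposite.op (ip u x) • u)
  have h2 : star (ip u x) * ip u u * ip u x ≤ star (ip u x) * 1 * ip u x :=
    star_left_conjugate_le_conjugate h1 _
  rw [ip_sub_left, ip_sub_right, ip_sub_right, ip_op_smul_right, ip_op_smul_left,
    ip_op_smul_left, ip_op_smul_right] at h0
  rw [star_ip, mul_one] at h2
  rw [star_ip] at h0
  have h3 : ip x u * (ip u u * ip u x) ≤ ip x u * ip u x := by rwa [← mul_assoc]
  have h4 : ip x x - ip x u * ip u x = (ip x x - ip x u * ip u x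
      - (ip x u * ip u x - ip x u * (ip u u * ip u x)))
      + (ip x u * ip u x - ip x u * (ip u u * ip u x)) := by abel
  rw [← sub_nonneg, h4]
  exact add_nonneg h0 (sub_nonneg.2 h3)

theorem norm_ip_le (u x : StdModule A) : ‖ip u x‖ ≤ ‖u‖ * ‖x‖ := by
  rcases eq_or_ne u 0 with rfl | hu
  · simp [ip, StdModule.zero_apply]
  have hu' : 0 < ‖u‖ := norm_pos_iff.2 hu
  have hc : ‖((‖u‖⁻¹ : ℝ) : ℂ)‖ = ‖u‖⁻¹ := Complex.norm_of_nonneg (by positivity)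
  set v : StdModule A := ((‖u‖⁻¹ : ℝ) : ℂ) • u
  have hv : ‖v‖ ≤ 1 := by rw [norm_smul, hc, inv_mul_cancel₀ hu'.ne']
  have h1 := CStarAlgebra.norm_le_norm_of_nonneg_of_le
    (by rw [← star_ip v x]; exact star_mul_self_nonneg _) (ip_mul_ip_le x hv)
  rw [← star_ip v x, CStarRing.norm_star_mul_self, ← norm_sq_eq, ← sq] at h1
  have h2 := (sq_le_sq₀ (norm_nonneg _) (norm_nonneg _)).1 h1
  rw [ip_smul_left, norm_smul, norm_star, hc, inv_mul_le_iff₀ hu'] at h2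
  exact h2

theorem norm_op_smul_le (a : A) (x : StdModule A) : ‖MulOpposite.op a • x‖ ≤ ‖x‖ * ‖a‖ := by
  refine (sq_le_sq₀ (norm_nonneg _) (by positivity)).1 ?_
  rw [norm_sq_eq, ip_op_smul_left, ip_op_smul_right]
  calc ‖star a * (ip x x * a)‖ ≤ ‖star a‖ * (‖ip x x‖ * ‖a‖) :=
        (norm_mul_le _ _).trans (by gcongr; exact norm_mul_le _ _)
    _ = (‖x‖ * ‖a‖) ^ 2 := by rw [norm_star, ← norm_sq_eq]; ring

theorem smul_op_smul (c : ℂ) (a : A) (x : StdModule A) :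
    c • (MulOpposite.op a • x) = MulOpposite.op (c • a) • x :=
  StdModule.ext fun j => by simp only [StdModule.smul_apply, StdModule.op_smul_apply,
    mul_smul_comm]

/-- A sequence with square summable coordinates, as an element of `H_A`. -/
def StdModule.mk (f : ℕ → A) (hf : Summable fun j => star (f j) * f j) : StdModule A :=
  show stdSubmodule A from ⟨f, hf⟩

theorem StdModule.mk_apply (f : ℕ → A) (hf : Summable fun j => star (f j) * f j) (j : ℕ) :
    StdModule.mk f hf j = f j := rfl

/-! ### Completeness of the standard module -/

theorem finNorm_vanishing (x : StdModule A) {ε : ℝ} (hε : 0 < ε) :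
    ∃ s : Finset ℕ, ∀ t, Disjoint t s → finNorm t x < ε := by
  obtain ⟨s, hs⟩ := summable_iff_vanishing_norm.1 x.summable (ε ^ 2) (by positivity)
  exact ⟨s, fun t ht => (Real.sqrt_lt' hε).2 (hs t ht)⟩

theorem summable_of_finNorm_vanishing {A : Type*} [CStarAlgebra A] {f : ℕ → A}
    (h : ∀ ε > 0, ∃ s : Finset ℕ, ∀ t, Disjoint t s → finNorm t f < ε) :
    Summable fun j => star (f j) * f j := by
  rw [summable_iff_vanishing_norm]
  intro ε hε
  obtain ⟨s, hs⟩ := h (√ε) (by positivity)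
  exact ⟨s, fun t ht => (Real.sqrt_lt_sqrt_iff (norm_nonneg _)).1 (hs t ht)⟩

instance : CompleteSpace (StdModule A) := by
  refine Metric.complete_of_cauchySeq_tendsto fun u hu => ?_
  have hcoord : ∀ j, ∃ a, Tendsto (fun n => u n j) atTop (𝓝 a) := by
    intro j
    refine cauchySeq_tendsto_of_complete (Metric.cauchySeq_iff.2 fun ε hε => ?_)
    obtain ⟨N, hN⟩ := Metric.cauchySeq_iff.1 hu ε hε
    refine ⟨N, fun m hm n hn => lt_of_le_of_lt ?_ (hN m hm n hn)⟩
    rw [dist_eq_norm, dist_eq_norm]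
    exact norm_apply_le (u m - u n) j
  choose f hf using hcoord
  -- on finitely many coordinates one can pass to the limit in the Cauchy condition
  have key : ∀ ε > 0, ∃ N, ∀ n ≥ N, ∀ s, finNorm s (f - (u n).coord) ≤ ε := by
    intro ε hε
    obtain ⟨N, hN⟩ := Metric.cauchySeq_iff.1 hu ε hε
    refine ⟨N, fun n hn s => ?_⟩
    have hlim : Tendsto (fun m => finNorm s (u m - u n : StdModule A)) atTop
        (𝓝 (finNorm s (f - (u n).coord))) := by
      refine (Real.continuous_sqrt.tendsto _).comp ((continuous_norm.tendsto _).comp ?_)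
      refine tendsto_finsetSum _ fun j _ => ?_
      have h : Tendsto (fun m => (u m - u n) j) atTop (𝓝 ((f - (u n).coord) j)) :=
        (hf j).sub_const _
      exact h.star.mul h
    refine le_of_tendsto hlim (eventually_atTop.2 ⟨N, fun m hm => ?_⟩)
    refine (finNorm_le_norm s _).trans ?_
    rw [← dist_eq_norm]
    exact (hN m hm n hn).le
  have hsum : Summable fun j => star (f j) * f j := by
    refine summable_of_finNorm_vanishing fun ε hε => ?_
    obtain ⟨N, hN⟩ := key (ε / 2) (by positivity)
    obtain ⟨s, hs⟩ := finNorm_vanishing (u N) (half_pos hε)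
    refine ⟨s, fun t ht => ?_⟩
    have h1 := finNorm_add_le t (f - (u N).coord) (u N)
    rw [sub_add_cancel] at h1
    linarith [hN N le_rfl t, hs t ht]
  refine ⟨StdModule.mk f hsum, Metric.tendsto_atTop.2 fun ε hε => ?_⟩
  obtain ⟨N, hN⟩ := key (ε / 2) (by positivity)
  refine ⟨N, fun n hn => ?_⟩
  rw [dist_comm, dist_eq_norm]
  refine lt_of_le_of_lt (norm_le_of_finNorm_le (c := ε / 2) fun s => ?_) (half_lt_self hε)
  exact hN n hn s

/-! ### Coordinate projections -/

theorem finNorm_indicator_le (t : Finset ℕ) (s : Set ℕ) (f : ℕ → A) :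
    finNorm t (s.indicator f) ≤ finNorm t f := by
  classical
  have h : finNorm t (s.indicator f) = finNorm (t.filter (· ∈ s)) f := by
    rw [finNorm, finNorm, Finset.sum_filter]
    congr 2
    refine Finset.sum_congr rfl fun j _ => ?_
    by_cases hj : j ∈ s <;> simp [hj]
  rw [h]
  exact finNorm_le_of_subset (Finset.filter_subset _ _) f

theorem summable_indicator (s : Set ℕ) (x : StdModule A) :
    Summable fun j => star (s.indicator x j) * s.indicator x j := by
  refine summable_of_finNorm_vanishing fun ε hε => ?_
  obtain ⟨t, ht⟩ := finNorm_vanishing x hε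
  exact ⟨t, fun u hu => (finNorm_indicator_le u s x).trans_lt (ht u hu)⟩

/-- The projection of `H_A` onto the sequences that are supported in `s`. -/
noncomputable def restr (s : Set ℕ) : StdModule A →L[ℂ] StdModule A :=
  LinearMap.mkContinuous
    { toFun := fun x => StdModule.mk (s.indicator x) (summable_indicator s x)
      map_add' := fun x y => StdModule.ext fun j => by
        simp only [StdModule.mk_apply, StdModule.add_apply]
        by_cases hj : j ∈ s <;> simp [hj, StdModule.add_apply]
      map_smul' := fun c x => StdModule.ext fun j => by
        simp only [StdModule.mk_apply, StdModule.smul_apply, RingHom.id_apply]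
        by_cases hj : j ∈ s <;> simp [hj, StdModule.smul_apply] } 1
    fun x => by
      rw [one_mul]
      exact norm_le_of_finNorm_le fun t =>
        (finNorm_indicator_le t s x).trans (finNorm_le_norm t x)

theorem restr_apply (s : Set ℕ) (x : StdModule A) (j : ℕ) :
    restr s x j = s.indicator x j := rfl

theorem norm_restr_apply_le (s : Set ℕ) (x : StdModule A) : ‖restr s x‖ ≤ ‖x‖ :=
  norm_le_of_finNorm_le fun t => (finNorm_indicator_le t s x).trans (finNorm_le_norm t x)

theorem restr_op_smul (s : Set ℕ) (a : A) (x : StdModule A) :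
    restr s (MulOpposite.op a • x) = MulOpposite.op a • restr s x :=
  StdModule.ext fun j => by
    rw [restr_apply, StdModule.op_smul_apply, restr_apply]
    by_cases hj : j ∈ s <;> simp [hj, StdModule.op_smul_apply]

theorem restr_restr (s t : Set ℕ) (x : StdModule A) : restr s (restr t x) = restr (s ∩ t) x :=
  StdModule.ext fun j => by
    simp only [restr_apply, ← Set.indicator_indicator]
    by_cases hj : j ∈ s <;> simp [hj, restr_apply]

theorem ip_restr_left (s : Set ℕ) (x y : StdModule A) : ip (restr s x) y = ip x (restr s y) := by
  refine tsum_congr fun j => ?_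
  rw [restr_apply, restr_apply]
  by_cases hj : j ∈ s <;> simp [hj]

theorem ip_restr_restr (s : Set ℕ) (x y : StdModule A) :
    ip (restr s x) (restr s y) = ip x (restr s y) := by
  rw [ip_restr_left, restr_restr, Set.inter_self]

theorem restr_add_restr_compl (s : Set ℕ) (x : StdModule A) : restr s x + restr sᶜ x = x :=
  StdModule.ext fun j => by
    rw [StdModule.add_apply, restr_apply, restr_apply]
    by_cases hj : j ∈ s <;> simp [hj]

theorem ip_restr_self_le (s : Set ℕ) (x : StdModule A) :
    ip (restr s x) (restr s x) ≤ ip x x := by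
  have h : ip x x = ip (restr s x) (restr s x) + ip (restr sᶜ x) (restr sᶜ x) := by
    rw [ip_restr_restr, ip_restr_restr, ← ip_add_right, restr_add_restr_compl]
  rw [h]
  exact le_add_of_nonneg_right (ip_self_nonneg _)

theorem sum_ip_restr {ι : Type*} (F : Finset ι) {B : ι → Set ℕ}
    (hB : Pairwise (Function.onFun Disjoint B)) (x : StdModule A) :
    ∑ i ∈ F, ip (restr (B i) x) (restr (B i) x) =
      ip (restr (⋃ i ∈ F, B i) x) (restr (⋃ i ∈ F, B i) x) := by
  classical
  induction F using Finset.induction_on with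
  | empty =>
    have h : restr (∅ : Set ℕ) x = 0 := StdModule.ext fun j => by
      simp [restr_apply, StdModule.zero_apply]
    simp [h, ip, StdModule.zero_apply]
  | insert a F ha ih =>
    rw [Finset.sum_insert ha, ih, Finset.set_biUnion_insert]
    have hd : Disjoint (B a) (⋃ i ∈ F, B i) := by
      rw [Set.disjoint_iUnion₂_right]
      exact fun i hi => hB fun e => ha (e ▸ hi)
    have h : restr (B a ∪ ⋃ i ∈ F, B i) x = restr (B a) x + restr (⋃ i ∈ F, B i) x :=
      StdModule.ext fun j => by
        simp only [restr_apply, StdModule.add_apply, Set.indicator_union_of_disjoint hd]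
    rw [ip_restr_restr, ip_restr_restr, ip_restr_restr, h, ip_add_right]

/-- The tails of an element of `H_A` tend to `0` in norm. -/
theorem tendsto_restr_Ici (x : StdModule A) :
    Tendsto (fun n => ‖restr (Set.Ici n) x‖) atTop (𝓝 0) := by
  refine Metric.tendsto_atTop.2 fun ε hε => ?_
  obtain ⟨s, hs⟩ := finNorm_vanishing x (half_pos hε)
  refine ⟨s.sup id + 1, fun n hn => ?_⟩
  rw [Real.dist_0_eq_abs, abs_norm]
  refine lt_of_le_of_lt (norm_le_of_finNorm_le (c := ε / 2) fun t => ?_) (half_lt_self hε)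
  have h : finNorm t (restr (Set.Ici n) x) = finNorm (t.filter (n ≤ ·)) x := by
    rw [finNorm, finNorm, Finset.sum_filter]
    congr 2
    refine Finset.sum_congr rfl fun j _ => ?_
    rw [restr_apply]
    by_cases hj : n ≤ j <;> simp [hj]
  rw [h]
  refine (hs _ (Finset.disjoint_left.2 fun j hj hjs => ?_)).le
  have h1 : j ≤ s.sup id := Finset.le_sup (f := id) hjs
  have h2 := (Finset.mem_filter.1 hj).2
  omega

/-- The sequences supported in `{0, …, n - 1}` form a free submodule of rank `n`. -/
def coordSubmodule (A : Type*) [CStarAlgebra A] [PartialOrder A] [StarOrderedRing A] (n : ℕ) :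
    Submodule Aᵐᵒᵖ (StdModule A) where
  carrier := {x | restr (Set.Ici n) x = 0}
  add_mem' := fun {x y} hx hy => by
    simp only [Set.mem_ofPred_eq] at hx hy ⊢
    rw [map_add, hx, hy, add_zero]
  zero_mem' := map_zero _
  smul_mem' := fun a x hx => by
    simp only [Set.mem_ofPred_eq] at hx ⊢
    rw [← MulOpposite.op_unop a, restr_op_smul, hx, smul_zero]

theorem mem_coordSubmodule {n : ℕ} {x : StdModule A} :
    x ∈ coordSubmodule A n ↔ restr (Set.Ici n) x = 0 := Iff.rfl

theorem mem_coordSubmodule_iff_apply {n : ℕ} {x : StdModule A} :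
    x ∈ coordSubmodule A n ↔ ∀ j, n ≤ j → x j = 0 := by
  rw [mem_coordSubmodule]
  constructor
  · intro h j hj
    have h1 : restr (Set.Ici n) x j = (0 : StdModule A) j := by rw [h]
    rwa [restr_apply, Set.indicator_of_mem (Set.mem_Ici.2 hj)] at h1
  · intro h
    refine StdModule.ext fun j => ?_
    rw [restr_apply]
    by_cases hj : j ∈ Set.Ici n
    · rw [Set.indicator_of_mem hj, h j hj]
      rfl
    · rw [Set.indicator_of_notMem hj]
      rfl

theorem summable_extend {A : Type*} [CStarAlgebra A] {n : ℕ} (f : Fin n → Aᵐᵒᵖ) :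
    Summable fun j => star (if h : j < n then (f ⟨j, h⟩).unop else 0) *
      (if h : j < n then (f ⟨j, h⟩).unop else 0) := by
  refine summable_of_ne_finset_zero (s := Finset.range n) fun j hj => ?_
  have : ¬ j < n := by simpa using hj
  simp [this]

/-- The coordinates identify `coordSubmodule A n` with `Aⁿ`. Right multiplication makes `A` free
of rank one over `Aᵐᵒᵖ`, with `Aᵐᵒᵖ` itself as a model. -/
def coordEquiv (n : ℕ) : coordSubmodule A n ≃ₗ[Aᵐᵒᵖ] (Fin n → Aᵐᵒᵖ) where
  toFun x i := MulOpposite.op ((x : StdModule A) i)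
  map_add' _ _ := rfl
  map_smul' a x := by
    ext i
    exact congrArg MulOpposite.op (StdModule.op_smul_apply a.unop (x : StdModule A) i)
  invFun f := ⟨StdModule.mk _ (summable_extend f), mem_coordSubmodule_iff_apply.2 fun j hj => by
    rw [StdModule.mk_apply, dif_neg (not_lt.2 hj)]⟩
  left_inv x := Subtype.ext (StdModule.ext fun j => by
    rw [StdModule.mk_apply]
    by_cases hj : j < n
    · simp [hj]
    · rw [dif_neg hj, mem_coordSubmodule_iff_apply.1 x.2 j (not_lt.1 hj)])
  right_inv f := by
    ext i
    simp [StdModule.mk_apply]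

theorem isFGProjective_coordSubmodule (n : ℕ) : IsFGProjective (coordSubmodule A n) where
  closed := isClosed_singleton.preimage (restr (Set.Ici n)).continuous
  finite := Module.Finite.equiv (coordEquiv n).symm
  projective := Module.Projective.of_equiv (coordEquiv n).symm

theorem infEDist_coordSubmodule_le (n : ℕ) (x : StdModule A) :
    Metric.infEDist x (coordSubmodule A n : Set (StdModule A)) ≤
      ENNReal.ofReal ‖restr (Set.Ici n) x‖ := by
  have hmem : restr (Set.Ici n)ᶜ x ∈ (coordSubmodule A n : Set (StdModule A)) := by
    refine mem_coordSubmodule_iff_apply.2 fun j hj => ?_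
    rw [restr_apply, Set.indicator_of_notMem]
    exact fun h => h hj
  refine (Metric.infEDist_le_edist_of_mem hmem).trans ?_
  rw [edist_eq_enorm_sub, ← ofReal_norm]
  refine ENNReal.ofReal_le_ofReal (le_of_eq ?_)
  congr 1
  rw [sub_eq_iff_eq_add, restr_add_restr_compl]

/-! ### States -/

theorem norm_one_add_of_nonneg [Nontrivial A] {a : A} (ha : 0 ≤ a) : ‖1 + a‖ = 1 + ‖a‖ := by
  refine le_antisymm ((norm_add_le _ _).trans_eq (by rw [CStarRing.norm_one])) ?_
  have h1 : (1 : A) ≤ 1 + a := le_add_of_nonneg_right ha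
  have h2 : (1 : ℝ) ≤ ‖1 + a‖ := by
    have := CStarAlgebra.norm_le_norm_of_nonneg_of_le (zero_le_one (α := A)) h1
    rwa [CStarRing.norm_one] at this
  have h3 : 1 + a ≤ algebraMap ℝ A ‖1 + a‖ :=
    IsSelfAdjoint.le_algebraMap_norm_self (.of_nonneg (zero_le_one.trans h1))
  have h4 : a ≤ algebraMap ℝ A (‖1 + a‖ - 1) := by
    rw [map_sub, map_one]
    exact le_sub_iff_add_le'.2 h3
  have h5 := (CStarAlgebra.norm_le_iff_le_algebraMap a (sub_nonneg.2 h2) ha).2 h4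
  linarith

/-- A functional with `‖g‖ = g(1) = 1` is real on self-adjoint elements: otherwise the norm of
`x + i t` would be too small for large `t`. -/
theorem im_apply_eq_zero_of_isSelfAdjoint {A : Type*} [CStarAlgebra A]
    (g : StrongDual ℂ A) (hg : ‖g‖ ≤ 1) (h1 : g 1 = 1)
    {x : A} (hx : IsSelfAdjoint x) : (g x).im = 0 := by
  have key : ∀ t : ℝ, ((g x).im + t) ^ 2 ≤ ‖x‖ ^ 2 + t ^ 2 * ‖(1 : A)‖ := by
    intro t
    have e1 : g (x + (t * Complex.I) • (1 : A)) = g x + t * Complex.I := by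
      rw [map_add, map_smul, h1, smul_eq_mul, mul_one]
    have e2 : ‖g x + t * Complex.I‖ ≤ ‖x + ((t : ℂ) * Complex.I) • (1 : A)‖ := by
      rw [← e1]
      exact (g.le_of_opNorm_le hg _).trans_eq (one_mul _)
    have e3 : ‖x + ((t : ℂ) * Complex.I) • (1 : A)‖ ^ 2 ≤ ‖x‖ ^ 2 + t ^ 2 * ‖(1 : A)‖ := by
      rw [sq, ← CStarRing.norm_star_mul_self]
      have : star (x + ((t : ℂ) * Complex.I) • (1 : A)) * (x + ((t : ℂ) * Complex.I) • (1 : A))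
          = star x * x + ((t : ℂ) ^ 2) • (1 : A) := by
        rw [star_add, star_smul, hx.star_eq, star_one]
        have hs : star ((t : ℂ) * Complex.I) = -((t : ℂ) * Complex.I) := by simp
        rw [hs]
        simp only [add_mul, mul_add, smul_mul_assoc, mul_smul_comm, one_mul, mul_one]
        have hI : -((t : ℂ) * Complex.I) * ((t : ℂ) * Complex.I) = (t : ℂ) ^ 2 := by
          linear_combination (-(t : ℂ) ^ 2) * Complex.I_mul_I
        rw [← hI]
        module
      rw [this]
      refine (norm_add_le _ _).trans (le_of_eq ?_)
      rw [CStarRing.norm_star_mul_self, norm_smul, norm_pow, Complex.norm_real, Real.norm_eq_abs,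
        sq_abs, sq ‖x‖]
    have e4 : ((g x).im + t) ^ 2 ≤ ‖g x + t * Complex.I‖ ^ 2 := by
      rw [← Complex.normSq_eq_norm_sq, Complex.normSq_apply]
      have : (g x + t * Complex.I).im = (g x).im + t := by simp
      rw [this]
      nlinarith [mul_self_nonneg (g x + t * Complex.I).re]
    have e5 := pow_le_pow_left₀ (norm_nonneg _) e2 2
    linarith
  -- without an instance of `Nontrivial A` only this much is known about `‖1‖`
  have hone : ‖(1 : A)‖ ≤ 1 := by
    have h := CStarRing.norm_star_mul_self (x := (1 : A))
    rw [star_one, mul_one] at h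
    nlinarith [norm_nonneg (1 : A), sq_nonneg (‖(1 : A)‖ - 1)]
  by_contra hne
  set b := (g x).im
  -- for this `t` the cross term `2 b t` alone exceeds `‖x‖²`
  have h2 := key ((‖x‖ ^ 2 + 1) / b)
  have h3 : ((‖x‖ ^ 2 + 1) / b) ^ 2 * ‖(1 : A)‖ ≤ ((‖x‖ ^ 2 + 1) / b) ^ 2 :=
    mul_le_of_le_one_right (sq_nonneg _) hone
  have h4 : b * ((‖x‖ ^ 2 + 1) / b) = ‖x‖ ^ 2 + 1 := by field_simp
  nlinarith [sq_nonneg b, sq_nonneg ‖x‖]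

theorem apply_nonneg_of_norm_le_one (g : StrongDual ℂ A) (hg : ‖g‖ ≤ 1) (h1 : g 1 = 1)
    {x : A} (hx : 0 ≤ x) : 0 ≤ g x := by
  have him := im_apply_eq_zero_of_isSelfAdjoint g hg h1 (IsSelfAdjoint.of_nonneg hx)
  have h2 : 0 ≤ algebraMap ℝ A ‖x‖ - x :=
    sub_nonneg.2 (IsSelfAdjoint.le_algebraMap_norm_self (.of_nonneg hx))
  have h3 : ‖algebraMap ℝ A ‖x‖ - x‖ ≤ ‖x‖ :=
    (CStarAlgebra.norm_le_iff_le_algebraMap _ (norm_nonneg x) h2).2 (sub_le_self _ hx)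
  have h4 : g (algebraMap ℝ A ‖x‖ - x) = ‖x‖ - g x := by
    rw [map_sub, Algebra.algebraMap_eq_smul_one, ← Complex.coe_smul, map_smul, h1, smul_eq_mul,
      mul_one]
  have h5 : ‖(‖x‖ : ℂ) - g x‖ ≤ ‖x‖ := by
    rw [← h4]
    exact (g.le_of_opNorm_le hg _).trans (by rwa [one_mul])
  have h6 := (Complex.re_le_norm _).trans h5
  rw [Complex.sub_re, Complex.ofReal_re] at h6
  exact Complex.nonneg_iff.2 ⟨by linarith, him.symm⟩

/-- A norming functional of `1 + a` has to take its largest possible values at `1` and at `a`;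
hence it is a state, and it attains the norm of `a`. -/
theorem exists_state_apply_eq_norm {a : A} (ha : 0 ≤ a) (ha0 : a ≠ 0) :
    ∃ φ : State A, φ.1 a = ‖a‖ := by
  have : Nontrivial A := nontrivial_of_ne a 0 ha0
  have hn := norm_one_add_of_nonneg ha
  obtain ⟨g, hg, hga⟩ := exists_dual_vector ℂ (1 + a) (by rw [hn]; positivity)
  have hsum : g 1 + g a = ((1 + ‖a‖ : ℝ) : ℂ) := by
    rw [← map_add, hga, hn]
    rfl
  have h1 : ‖g 1‖ ≤ 1 := by
    have := g.le_opNorm 1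
    rwa [hg, CStarRing.norm_one, one_mul] at this
  have h2 : ‖g a‖ ≤ ‖a‖ := by
    have := g.le_opNorm a
    rwa [hg, one_mul] at this
  have hre : (g 1).re + (g a).re = 1 + ‖a‖ := by
    rw [← Complex.add_re, hsum, Complex.ofReal_re]
  have r1 : (g 1).re = 1 := by
    linarith [(Complex.re_le_norm _).trans h1, (Complex.re_le_norm _).trans h2]
  have g1 : g 1 = 1 := by
    have h3 : (g 1).re ^ 2 + (g 1).im ^ 2 ≤ 1 := by
      have h4 := Complex.normSq_eq_norm_sq (g 1)
      rw [Complex.normSq_apply] at h4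
      nlinarith [norm_nonneg (g 1)]
    refine Complex.ext (by simpa using r1) ?_
    rw [r1] at h3
    have h4 : (g 1).im ^ 2 ≤ 0 := by linarith
    simpa using h4
  have gA : g a = ‖a‖ := by
    rw [g1] at hsum
    push_cast at hsum
    exact add_left_cancel hsum
  refine ⟨⟨PositiveLinearMap.mk₀ (g : A →ₗ[ℂ] ℂ)
    fun x hx => apply_nonneg_of_norm_le_one g hg.le g1 hx, g1⟩, gA⟩

theorem State.norm_apply_star (φ : State A) (a : A) : ‖φ.1 (star a)‖ = ‖φ.1 a‖ := by
  rw [map_star, norm_star]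

/-- The Kadison–Schwarz inequality for states. -/
theorem State.norm_apply_sq_le (φ : State A) (a : A) : ‖φ.1 a‖ ^ 2 ≤ (φ.1 (star a * a)).re := by
  set c := φ.1 a with hc
  have h0 : 0 ≤ φ.1 (star (a - c • (1 : A)) * (a - c • (1 : A))) :=
    φ.1.map_nonneg (star_mul_self_nonneg _)
  have e : star (a - c • (1 : A)) * (a - c • (1 : A))
      = star a * a - c • star a - (star c) • a + (star c * c) • (1 : A) := by
    rw [star_sub, star_smul, star_one]
    simp only [sub_mul, mul_sub, smul_mul_assoc, mul_smul_comm, one_mul, mul_one]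
    module
  rw [e, map_add, map_sub, map_sub, map_smul, map_smul, map_smul, φ.2, map_star, ← hc] at h0
  have h1 := (Complex.nonneg_iff.1 h0).1
  have h2 : (star c * c).re = ‖c‖ ^ 2 := by
    rw [← Complex.normSq_eq_norm_sq, Complex.normSq_apply]
    simp
  simp only [Complex.add_re, Complex.sub_re, smul_eq_mul, mul_one] at h1
  rw [mul_comm c, h2] at h1
  linarith

theorem State.re_apply_le (φ : State A) {a : A} (ha : 0 ≤ a) : (φ.1 a).re ≤ ‖a‖ := by
  have h := φ.1.norm_apply_le_of_nonneg a ha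
  rw [φ.2, norm_one, one_mul] at h
  exact (Complex.re_le_norm _).trans h

theorem State.norm_apply_le (φ : State A) (a : A) : ‖φ.1 a‖ ≤ ‖a‖ := by
  refine (sq_le_sq₀ (norm_nonneg _) (norm_nonneg _)).1 ((φ.norm_apply_sq_le a).trans ?_)
  refine (φ.re_apply_le (star_mul_self_nonneg a)).trans_eq ?_
  rw [CStarRing.norm_star_mul_self, sq]

theorem State.sum_norm_apply_sq_le (φ : State A) (s : Finset ℕ) (w : StdModule A) :
    ∑ i ∈ s, ‖φ.1 (w i)‖ ^ 2 ≤ ‖w‖ ^ 2 := by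
  calc ∑ i ∈ s, ‖φ.1 (w i)‖ ^ 2 ≤ ∑ i ∈ s, (φ.1 (star (w i) * w i)).re :=
        Finset.sum_le_sum fun i _ => φ.norm_apply_sq_le _
    _ = (φ.1 (∑ i ∈ s, star (w i) * w i)).re := by rw [map_sum, Complex.re_sum]
    _ ≤ ‖∑ i ∈ s, star (w i) * w i‖ :=
        φ.re_apply_le (Finset.sum_nonneg fun _ _ => star_mul_self_nonneg _)
    _ = finNorm s w ^ 2 := (Real.sq_sqrt (norm_nonneg _)).symm
    _ ≤ ‖w‖ ^ 2 := pow_le_pow_left₀ (Real.sqrt_nonneg _) (finNorm_le_norm s w) 2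

/-! ### The seminorms of Troitsky -/

/-- The function `w ↦ (sup_k ∑_{i ≥ k} |φ_k(w_i)|²)^{1/2}` on `H_A`. -/
noncomputable def stateNorm (Φ : ℕ → State A) (w : StdModule A) : ℝ :=
  √(⨆ k, ∑' i, ‖(Φ k).1 (w (k + i))‖ ^ 2)

theorem sum_shift_le (Φ : ℕ → State A) (w : StdModule A) (k : ℕ) (s : Finset ℕ) :
    ∑ i ∈ s, ‖(Φ k).1 (w (k + i))‖ ^ 2 ≤ ‖w‖ ^ 2 := by
  have h := (Φ k).sum_norm_apply_sq_le (s.map (addLeftEmbedding k)) w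
  rwa [Finset.sum_map] at h

theorem summable_shift (Φ : ℕ → State A) (w : StdModule A) (k : ℕ) :
    Summable fun i => ‖(Φ k).1 (w (k + i))‖ ^ 2 :=
  summable_of_sum_le (fun _ => by positivity) (sum_shift_le Φ w k)

theorem bddAbove_shift (Φ : ℕ → State A) (w : StdModule A) :
    BddAbove (Set.range fun k => ∑' i, ‖(Φ k).1 (w (k + i))‖ ^ 2) := by
  refine ⟨‖w‖ ^ 2, ?_⟩
  rintro _ ⟨k, rfl⟩
  exact (summable_shift Φ w k).tsum_le_of_sum_le (sum_shift_le Φ w k)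

theorem stateNorm_le_iff (Φ : ℕ → State A) (w : StdModule A) {c : ℝ} (hc : 0 ≤ c) :
    stateNorm Φ w ≤ c ↔
      ∀ (k : ℕ) (s : Finset ℕ), ∑ i ∈ s, ‖(Φ k).1 (w (k + i))‖ ^ 2 ≤ c ^ 2 := by
  rw [stateNorm, Real.sqrt_le_iff]
  constructor
  · rintro ⟨-, h⟩ k s
    exact ((summable_shift Φ w k).sum_le_tsum s fun _ _ => by positivity).trans
      ((le_ciSup (bddAbove_shift Φ w) k).trans h)
  · exact fun h => ⟨hc, ciSup_le fun k => (summable_shift Φ w k).tsum_le_of_sum_le (h k)⟩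

theorem stateNorm_add_le (Φ : ℕ → State A) (v w : StdModule A) :
    stateNorm Φ (v + w) ≤ stateNorm Φ v + stateNorm Φ w := by
  have hv : 0 ≤ stateNorm Φ v := Real.sqrt_nonneg _
  have hw : 0 ≤ stateNorm Φ w := Real.sqrt_nonneg _
  rw [stateNorm_le_iff Φ _ (add_nonneg hv hw)]
  intro k s
  have h1 := (stateNorm_le_iff Φ v hv).1 le_rfl k s
  have h2 := (stateNorm_le_iff Φ w hw).1 le_rfl k s
  set a : ℕ → ℝ := fun i => ‖(Φ k).1 (v (k + i))‖
  set b : ℕ → ℝ := fun i => ‖(Φ k).1 (w (k + i))‖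
  have h3 : ∑ i ∈ s, a i * b i ≤ stateNorm Φ v * stateNorm Φ w := by
    refine le_of_sq_le_sq ?_ (mul_nonneg hv hw)
    refine (Finset.sum_mul_sq_le_sq_mul_sq s a b).trans ?_
    rw [mul_pow]
    exact mul_le_mul h1 h2 (Finset.sum_nonneg fun _ _ => sq_nonneg _) (sq_nonneg _)
  calc ∑ i ∈ s, ‖(Φ k).1 ((v + w) (k + i))‖ ^ 2 ≤ ∑ i ∈ s, (a i + b i) ^ 2 := by
        refine Finset.sum_le_sum fun i _ => pow_le_pow_left₀ (norm_nonneg _) ?_ 2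
        rw [StdModule.add_apply, map_add]
        exact norm_add_le _ _
    _ = ∑ i ∈ s, a i ^ 2 + ∑ i ∈ s, b i ^ 2 + 2 * ∑ i ∈ s, a i * b i := by
        rw [Finset.mul_sum, ← Finset.sum_add_distrib, ← Finset.sum_add_distrib]
        exact Finset.sum_congr rfl fun i _ => by ring
    _ ≤ (stateNorm Φ v + stateNorm Φ w) ^ 2 := by nlinarith

theorem stateNorm_smul (Φ : ℕ → State A) (c : ℂ) (w : StdModule A) :
    stateNorm Φ (c • w) = ‖c‖ * stateNorm Φ w := by
  have h : ∀ k i, ‖(Φ k).1 ((c • w) (k + i))‖ ^ 2 = ‖c‖ ^ 2 * ‖(Φ k).1 (w (k + i))‖ ^ 2 := by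
    intro k i
    rw [StdModule.smul_apply, map_smul, smul_eq_mul, norm_mul, mul_pow]
  rw [stateNorm, stateNorm]
  simp only [h, tsum_mul_left]
  rw [← Real.mul_iSup_of_nonneg (sq_nonneg _), Real.sqrt_mul (sq_nonneg _),
    Real.sqrt_sq (norm_nonneg _)]

/-- `stateNorm` as a seminorm. -/
noncomputable def stateSeminorm (Φ : ℕ → State A) : Seminorm ℂ (StdModule A) :=
  Seminorm.of (stateNorm Φ) (stateNorm_add_le Φ) (stateNorm_smul Φ)

theorem stateSeminorm_le_norm (Φ : ℕ → State A) (w : StdModule A) :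
    stateSeminorm Φ w ≤ ‖w‖ :=
  (stateNorm_le_iff Φ w (norm_nonneg _)).2 (sum_shift_le Φ w)

theorem norm_apply_le_stateSeminorm (Φ : ℕ → State A) (w : StdModule A) (k : ℕ) :
    ‖(Φ k).1 (w k)‖ ≤ stateSeminorm Φ w := by
  have h := (stateNorm_le_iff Φ w (Real.sqrt_nonneg _)).1 le_rfl k {0}
  rw [Finset.sum_singleton, add_zero] at h
  exact (sq_le_sq₀ (norm_nonneg _) (Real.sqrt_nonneg _)).1 h

/-- Up to the norm of a tail, `stateSeminorm` depends on finitely many functionals only. -/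
theorem stateSeminorm_le_of_tail (Φ : ℕ → State A) (w : StdModule A) {m : ℕ} {η : ℝ}
    (hη : 0 ≤ η) (h : ∀ k < m, ∀ i < m, ‖(Φ k).1 (w i)‖ ≤ η) :
    stateSeminorm Φ w ≤ m * η + ‖restr (Set.Ici m) w‖ := by
  have h1 : stateSeminorm Φ (restr (Set.Ici m)ᶜ w) ≤ m * η := by
    refine (stateNorm_le_iff Φ _ (by positivity)).2 fun k s => ?_
    have h2 : ∀ i, ‖(Φ k).1 (restr (Set.Ici m)ᶜ w (k + i))‖ ^ 2 ≤ if i < m then η ^ 2 else 0 := by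
      intro i
      rw [restr_apply]
      by_cases hi : k + i < m
      · rw [Set.indicator_of_mem (by simpa using hi), if_pos (by omega)]
        exact pow_le_pow_left₀ (norm_nonneg _) (h k (by omega) _ hi) 2
      · rw [Set.indicator_of_notMem (by simpa using hi), map_zero, norm_zero, zero_pow two_ne_zero]
        split_ifs
        · positivity
        · exact le_rfl
    calc ∑ i ∈ s, ‖(Φ k).1 (restr (Set.Ici m)ᶜ w (k + i))‖ ^ 2
        ≤ ∑ i ∈ s, if i < m then η ^ 2 else 0 := Finset.sum_le_sum fun i _ => h2 i
      _ = (s.filter (· < m)).card * η ^ 2 := by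
          rw [← Finset.sum_filter, Finset.sum_const, nsmul_eq_mul]
      _ ≤ m * η ^ 2 := by
          gcongr
          refine (Finset.card_le_card fun i hi => ?_).trans_eq (Finset.card_range m)
          exact Finset.mem_range.2 (Finset.mem_filter.1 hi).2
      _ ≤ (m * η) ^ 2 := by
          rw [mul_pow]
          gcongr
          rcases Nat.eq_zero_or_pos m with rfl | hm
          · simp
          · exact le_self_pow₀ (by exact_mod_cast hm) two_ne_zero
  have h3 := map_add_le_add (stateSeminorm Φ) (restr (Set.Ici m) w) (restr (Set.Ici m)ᶜ w)
  rw [restr_add_restr_compl] at h3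
  linarith [stateSeminorm_le_norm Φ (restr (Set.Ici m) w)]

theorem Admissible.star_mul_self_eq (X : ℕ → StdModule A) (x : StdModule A) (i : ℕ) :
    star (ip (X i) x) * ip (X i) x = ip x (X i) * ip (X i) x := by
  rw [star_ip]

/-- The analysis operator `x ↦ (⟨x_i, x⟩)_i` of an admissible sequence; admissibility says that
it is a well-defined contraction of `H_A`. -/
noncomputable def Admissible.analysis {X : ℕ → StdModule A} (hX : Admissible X) :
    StdModule A →L[ℂ] StdModule A :=
  LinearMap.mkContinuous
    { toFun := fun x => StdModule.mk (fun i => ip (X i) x) <| by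
        simp only [Admissible.star_mul_self_eq]
        exact hX.summable x
      map_add' := fun x y => StdModule.ext fun i => ip_add_right (X i) x y
      map_smul' := fun c x => StdModule.ext fun i => ip_smul_right c (X i) x } 1
    fun x => by
      rw [one_mul]
      refine (sq_le_sq₀ (norm_nonneg _) (norm_nonneg _)).1 ?_
      rw [norm_sq_eq, norm_sq_eq]
      refine CStarAlgebra.norm_le_norm_of_nonneg_of_le (ip_self_nonneg _) ?_
      refine le_trans (le_of_eq ?_) (hX.tsum_le x)
      exact tsum_congr fun i => Admissible.star_mul_self_eq X x i

theorem Admissible.analysis_apply {X : ℕ → StdModule A} (hX : Admissible X) (x : StdModule A)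
    (i : ℕ) : hX.analysis x i = ip (X i) x := rfl

theorem Admissible.norm_analysis_le {X : ℕ → StdModule A} (hX : Admissible X)
    (x : StdModule A) : ‖hX.analysis x‖ ≤ ‖x‖ :=
  (ContinuousLinearMap.le_of_opNorm_le _
    (LinearMap.mkContinuous_norm_le _ zero_le_one _) x).trans_eq (one_mul _)

theorem Admissible.analysis_op_smul {X : ℕ → StdModule A} (hX : Admissible X) (a : A)
    (x : StdModule A) :
    hX.analysis (MulOpposite.op a • x) = MulOpposite.op a • hX.analysis x :=
  StdModule.ext fun i => ip_op_smul_right a (X i) x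

/-- `troitskySeminorm` of an admissible sequence, as a seminorm. -/
noncomputable def Admissible.seminorm {X : ℕ → StdModule A} (hX : Admissible X)
    (Φ : ℕ → State A) : Seminorm ℂ (StdModule A) :=
  (stateSeminorm Φ).comp (hX.analysis : StdModule A →ₗ[ℂ] StdModule A)

theorem Admissible.seminorm_apply {X : ℕ → StdModule A} (hX : Admissible X)
    (Φ : ℕ → State A) (x : StdModule A) :
    hX.seminorm Φ x = stateSeminorm Φ (hX.analysis x) := rfl

theorem Admissible.seminorm_le_norm {X : ℕ → StdModule A} (hX : Admissible X)
    (Φ : ℕ → State A) (x : StdModule A) : hX.seminorm Φ x ≤ ‖x‖ :=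
  (stateSeminorm_le_norm Φ _).trans (hX.norm_analysis_le x)

theorem Admissible.troitskyDist_eq {X : ℕ → StdModule A} (hX : Admissible X)
    (Φ : ℕ → State A) : troitskyDist X Φ = fun x y => hX.seminorm Φ (x - y) := by
  funext x y
  have h : ∀ k i, ‖(Φ k).1 (ip (x - y) (X (k + i)))‖ =
      ‖(Φ k).1 (hX.analysis (x - y) (k + i))‖ := by
    intro k i
    rw [hX.analysis_apply, ← star_ip, State.norm_apply_star]
  rw [troitskyDist, troitskySeminorm]
  simp only [h]
  rfl

/-! ### Bounded sets in finitely generated submodules -/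

/-- The operator `(a_j) ↦ ∑ g_j a_j` from `Aⁿ` to `H_A`. -/
noncomputable def synthesis {n : ℕ} (g : Fin n → StdModule A) :
    (Fin n → A) →L[ℂ] StdModule A :=
  ∑ j, (LinearMap.mkContinuous
    { toFun := fun a : A => MulOpposite.op a • g j
      map_add' := fun a b => by rw [MulOpposite.op_add, add_smul]
      map_smul' := fun c a => by rw [RingHom.id_apply, smul_op_smul] } ‖g j‖
    fun a => norm_op_smul_le a (g j)).comp (ContinuousLinearMap.proj j)

theorem synthesis_apply {n : ℕ} (g : Fin n → StdModule A) (a : Fin n → A) :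
    synthesis g a = ∑ j, MulOpposite.op (a j) • g j := by
  rw [synthesis, sum_apply]
  rfl

/-- In a closed finitely generated submodule the coefficients with respect to a finite set of
generators can be bounded by the norm, by the open mapping theorem for `Aⁿ → L`. -/
theorem exists_bounded_coefficients {L : Submodule Aᵐᵒᵖ (StdModule A)}
    (hc : IsClosed (L : Set (StdModule A))) (hL : Module.Finite Aᵐᵒᵖ L) :
    ∃ (n : ℕ) (g : Fin n → StdModule A) (C : ℝ), 0 < C ∧ ∀ z ∈ L, ∃ a : Fin n → A,
      z = ∑ j, MulOpposite.op (a j) • g j ∧ ∀ j, ‖a j‖ ≤ C * ‖z‖ := by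
  obtain ⟨n, g, hg⟩ := Submodule.fg_iff_exists_fin_generating_family.1 (Module.Finite.iff_fg.1 hL)
  have hmem : ∀ z, z ∈ LinearMap.range (synthesis g : (Fin n → A) →ₗ[ℂ] StdModule A) ↔ z ∈ L := by
    intro z
    rw [← hg, Submodule.mem_span_range_iff_exists_fun, LinearMap.mem_range]
    constructor
    · rintro ⟨a, ha⟩
      exact ⟨fun j => MulOpposite.op (a j), by rw [← ha]; exact (synthesis_apply g a).symm⟩
    · rintro ⟨a, ha⟩
      exact ⟨fun j => (a j).unop, by rw [← ha]; exact synthesis_apply g _⟩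
  set R := LinearMap.range (synthesis g : (Fin n → A) →ₗ[ℂ] StdModule A)
  have hR : (R : Set (StdModule A)) = L := Set.ext hmem
  have hRc : IsClosed (R : Set (StdModule A)) := hR ▸ hc
  have : CompleteSpace R := hRc.completeSpace_coe
  obtain ⟨C, hC, h⟩ := ((synthesis g).codRestrict R fun a => ⟨a, rfl⟩).exists_preimage_norm_le
    (by rintro ⟨_, a, rfl⟩; exact ⟨a, rfl⟩)
  refine ⟨n, g, C, hC, fun z hz => ?_⟩
  obtain ⟨a, ha, hbd⟩ := h ⟨z, (hmem z).2 hz⟩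
  refine ⟨a, ?_, fun j => (norm_le_pi_norm a j).trans hbd⟩
  rw [← synthesis_apply]
  exact (congrArg Subtype.val ha).symm

/-- The tails of `θ z` are uniformly small for `z` in a bounded part of a closed finitely
generated submodule, where `θ` is the analysis operator. -/
theorem Admissible.exists_uniform_tail {X : ℕ → StdModule A} (hX : Admissible X)
    {L : Submodule Aᵐᵒᵖ (StdModule A)} (hL : IsFGProjective L) (R : ℝ) {δ : ℝ} (hδ : 0 < δ) :
    ∃ m, ∀ z ∈ L, ‖z‖ ≤ R → ‖restr (Set.Ici m) (hX.analysis z)‖ ≤ δ := by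
  obtain ⟨n, g, C, hC, h⟩ := exists_bounded_coefficients hL.closed hL.finite
  have hlim : Tendsto (fun m => ∑ j, ‖restr (Set.Ici m) (hX.analysis (g j))‖ * (C * R)) atTop
      (𝓝 0) := by
    have := tendsto_finsetSum (Finset.univ : Finset (Fin n)) fun j _ =>
      (tendsto_restr_Ici (hX.analysis (g j))).mul_const (C * R)
    simpa using this
  obtain ⟨m, hm⟩ := (hlim.eventually (eventually_le_nhds hδ)).exists
  refine ⟨m, fun z hz hzR => le_trans ?_ hm⟩
  obtain ⟨a, rfl, ha⟩ := h z hz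
  rw [map_sum, map_sum]
  refine (norm_sum_le _ _).trans (Finset.sum_le_sum fun j _ => ?_)
  rw [hX.analysis_op_smul, restr_op_smul]
  refine (norm_op_smul_le _ _).trans ?_
  gcongr
  exact (ha j).trans (by gcongr)

/-- Bounded parts of closed finitely generated submodules are totally bounded for the seminorms
of Troitsky: the tails are uniformly small, and what remains are finitely many functionals. -/
theorem Admissible.exists_finite_net {X : ℕ → StdModule A} (hX : Admissible X)
    (Φ : ℕ → State A) {L : Submodule Aᵐᵒᵖ (StdModule A)} (hL : IsFGProjective L) (R : ℝ)
    {ε : ℝ} (hε : 0 < ε) :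
    ∃ C : Set (StdModule A), C.Finite ∧
      ∀ z ∈ L, ‖z‖ ≤ R → ∃ c ∈ C, hX.seminorm Φ (c - z) < ε := by
  obtain ⟨m, hm⟩ := hX.exists_uniform_tail hL R (δ := ε / 4) (by positivity)
  -- the finitely many functionals contribute `m η < ε / 2`, the tails of `c` and `z` at most
  -- `ε / 4` each
  set η : ℝ := ε / (4 * (m + 1)) with hη
  have hη0 : 0 < η := by positivity
  set Z : Set (StdModule A) := {z | z ∈ L ∧ ‖z‖ ≤ R}
  -- only the `φ_k` with `k < m` matter, as `φ_k` is applied to coordinates from the `k`-th on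
  let f : StdModule A → (Fin m × Fin m → ℂ) := fun z q => (Φ q.1).1 (hX.analysis z q.2)
  have hbd : Bornology.IsBounded (f '' Z) := by
    refine (Metric.isBounded_closedBall (x := (0 : Fin m × Fin m → ℂ)) (r := max R 0)).subset ?_
    rintro _ ⟨z, hz, rfl⟩
    rw [mem_closedBall_zero_iff, pi_norm_le_iff_of_nonneg (le_max_right _ _)]
    intro q
    refine le_trans ?_ (hz.2.trans (le_max_left _ _))
    exact ((Φ q.1).norm_apply_le _).trans ((norm_apply_le _ _).trans (hX.norm_analysis_le z))
  obtain ⟨t, htZ, htf, ht⟩ := Metric.finite_approx_of_totallyBounded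
    (hbd.isCompact_closure.totallyBounded.subset subset_closure) η hη0
  have hpre : ∀ y, ∃ z, y ∈ t → z ∈ Z ∧ f z = y := by
    intro y
    by_cases hy : y ∈ t
    · obtain ⟨z, hz, hzy⟩ := htZ hy
      exact ⟨z, fun _ => ⟨hz, hzy⟩⟩
    · exact ⟨0, fun h => absurd h hy⟩
  choose c hc using hpre
  refine ⟨c '' t, htf.image c, fun z hz hzR => ?_⟩
  obtain ⟨y, hy, hzy⟩ := Set.mem_iUnion₂.1 (ht ⟨z, ⟨hz, hzR⟩, rfl⟩)
  refine ⟨c y, ⟨y, hy, rfl⟩, ?_⟩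
  obtain ⟨hcZ, hcy⟩ := hc y hy
  have h1 : ∀ k < m, ∀ i < m, ‖(Φ k).1 (hX.analysis (c y - z) i)‖ ≤ η := by
    intro k hk i hi
    have h2 : dist (f z (⟨k, hk⟩, ⟨i, hi⟩)) (f (c y) (⟨k, hk⟩, ⟨i, hi⟩)) ≤ η := by
      refine (dist_le_pi_dist (f z) (f (c y)) _).trans ?_
      rw [hcy]
      exact (Metric.mem_ball.1 hzy).le
    rw [dist_comm, dist_eq_norm] at h2
    rwa [map_sub, StdModule.sub_apply, map_sub]
  have h3 := stateSeminorm_le_of_tail Φ (hX.analysis (c y - z)) hη0.le h1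
  have h4 : ‖restr (Set.Ici m) (hX.analysis (c y - z))‖ ≤ ε / 4 + ε / 4 := by
    rw [map_sub, map_sub]
    exact (norm_sub_le _ _).trans (add_le_add (hm _ hcZ.1 hcZ.2) (hm z hz hzR))
  have h5 : m * η < ε / 2 := by
    have : (m + 1) * η = ε / 4 := by rw [hη]; field_simp
    nlinarith
  rw [hX.seminorm_apply]
  linarith

theorem starMNC_hausdorff_le_lambdaMNC {E : Set (StdModule A)} {R : ℝ}
    (hE : ∀ y ∈ E, ‖y‖ ≤ R) : starMNC hausdorff E ≤ lambdaMNC E := by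
  refine iSup_le fun X => iSup_le fun hX => iSup_le fun Φ => le_iInf₂ fun L hL => ?_
  rw [hX.troitskyDist_eq]
  refine ENNReal.le_of_forall_pos_le_add fun ε hε hs => ?_
  set s := ⨆ x ∈ E, Metric.infEDist x (L : Set (StdModule A)) with hsdef
  have hε' : (0 : ℝ) < ε := hε
  have hs0 : 0 ≤ s.toReal := ENNReal.toReal_nonneg
  set r : ℝ := s.toReal + ε / 2 with hr
  obtain ⟨C, hC, hnet⟩ := hX.exists_finite_net Φ hL (R + r) (half_pos hε')
  have hle : ENNReal.ofReal (s.toReal + ε) = s + ε := by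
    rw [ENNReal.ofReal_add hs0 hε'.le, ENNReal.ofReal_toReal hs.ne, ENNReal.ofReal_coe_nnreal]
  rw [← hle]
  refine sInf_le ⟨s.toReal + ε, ⟨by positivity, C, hC, fun y hy => ?_⟩, rfl⟩
  have h1 : Metric.infEDist y (L : Set (StdModule A)) < ENNReal.ofReal r := by
    refine lt_of_le_of_lt (le_iSup₂ (f := fun x (_ : x ∈ E) =>
      Metric.infEDist x (L : Set (StdModule A))) y hy) ?_
    rw [← hsdef, ENNReal.lt_ofReal_iff_toReal_lt hs.ne]
    linarith
  obtain ⟨z, hz, hyz⟩ := Metric.infEDist_lt_iff.1 h1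
  rw [edist_dist, ENNReal.ofReal_lt_ofReal_iff (by positivity), dist_eq_norm] at hyz
  have hzR : ‖z‖ ≤ R + r := by
    have := norm_sub_le y (y - z)
    rw [sub_sub_cancel] at this
    linarith [hE y hy]
  obtain ⟨c, hc, hcz⟩ := hnet z hz hzR
  refine Set.mem_iUnion₂.2 ⟨c, hc, ?_⟩
  have h2 := map_add_le_add (hX.seminorm Φ) (c - z) (z - y)
  rw [sub_add_sub_cancel] at h2
  have h3 := hX.seminorm_le_norm Φ (z - y)
  rw [norm_sub_rev] at h3
  simp only [Set.mem_ofPred_eq]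
  linarith

/-! ### A lower bound from disjoint blocks -/

/-- Vectors of norm at most `1` that are supported in disjoint blocks which move to infinity form
an admissible sequence. -/
theorem admissible_of_blocks {B : ℕ → Set ℕ} (hB : Pairwise (Function.onFun Disjoint B))
    (hBi : ∀ i, B i ⊆ Set.Ici i) {u : ℕ → StdModule A} (hu : ∀ i, ‖u i‖ ≤ 1)
    (huB : ∀ i, restr (B i) (u i) = u i) : Admissible u := by
  have hterm : ∀ x i, ip x (u i) * ip (u i) x ≤ ip (restr (B i) x) (restr (B i) x) := by
    intro x i
    have h := ip_mul_ip_le (restr (B i) x) (hu i)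
    rwa [ip_restr_left, ← ip_restr_left (B i) (u i) x, huB] at h
  have hpos : ∀ x i, 0 ≤ ip x (u i) * ip (u i) x := by
    intro x i
    rw [← star_ip (u i) x]
    exact star_mul_self_nonneg _
  have hsum : ∀ x (F : Finset ℕ), ∑ i ∈ F, ip x (u i) * ip (u i) x ≤
      ip (restr (⋃ i ∈ F, B i) x) (restr (⋃ i ∈ F, B i) x) := by
    intro x F
    rw [← sum_ip_restr F hB x]
    exact Finset.sum_le_sum fun i _ => hterm x i
  have hsummable : ∀ x, Summable fun i => ip x (u i) * ip (u i) x := by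
    intro x
    rw [summable_iff_vanishing_norm]
    intro ε hε
    obtain ⟨n, hn⟩ := ((tendsto_restr_Ici x).eventually
      (eventually_lt_nhds (Real.sqrt_pos.2 hε))).exists
    refine ⟨Finset.range n, fun F hF => ?_⟩
    have hsub : (⋃ i ∈ F, B i) ⊆ Set.Ici n := by
      refine Set.iUnion₂_subset fun i hi => (hBi i).trans (Set.Ici_subset_Ici.2 ?_)
      by_contra! hlt
      exact Finset.disjoint_left.1 hF hi (Finset.mem_range.2 hlt)
    refine (CStarAlgebra.norm_le_norm_of_nonneg_of_le
      (Finset.sum_nonneg fun i _ => hpos x i) (hsum x F)).trans_lt ?_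
    rw [← norm_sq_eq, ← Real.lt_sqrt (norm_nonneg _)]
    refine lt_of_le_of_lt ?_ hn
    rw [← Set.inter_eq_left.2 hsub, ← restr_restr]
    exact norm_restr_apply_le _ _
  exact ⟨hsummable, fun x => (hsummable x).tsum_le_of_sum_le fun F =>
    (hsum x F).trans (ip_restr_self_le _ x), hu⟩

/-- If all tails of `T` have norm larger than `c`, there are `x_i` in the unit ball such that
suitable disjoint blocks `y_i` of `T x_i` have norm larger than `c`. The normalized blocks form an
admissible sequence, and a state `φ_i` with `φ_i(⟨y_i, y_i⟩) = ‖y_i‖²` sees `T x_i` with value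
larger than `c`. As `φ_i(⟨u_i, z⟩) → 0` for every `z`, finitely many centres cannot serve
infinitely many of the `T x_i`. -/
theorem ofReal_le_chiOp (T : StdModule A →L[ℂ] StdModule A) {c : ℝ} (hc : 0 ≤ c)
    (h : ∀ n, c < ‖(restr (Set.Ici n)).comp T‖) : ENNReal.ofReal c ≤ chiOp T := by
  have step : ∀ n, ∃ m x, n < m ∧ ‖x‖ ≤ 1 ∧ c < ‖restr (Set.Ico n m) (T x)‖ := by
    intro n
    obtain ⟨x, hx, hcx⟩ := ((restr (Set.Ici n)).comp T).exists_lt_apply_of_lt_opNorm (h n)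
    rw [ContinuousLinearMap.comp_apply] at hcx
    obtain ⟨m, hm, hnm⟩ := (((tendsto_restr_Ici (T x)).eventually
      (eventually_lt_nhds (sub_pos.2 hcx))).and (eventually_gt_atTop n)).exists
    refine ⟨m, x, hnm, hx.le, ?_⟩
    have h1 : restr (Set.Ici n) (T x) = restr (Set.Ico n m) (T x) + restr (Set.Ici m) (T x) := by
      refine StdModule.ext fun j => ?_
      simp only [StdModule.add_apply, restr_apply]
      rw [← Set.Ico_union_Ici_eq_Ici hnm.le, Set.indicator_union_of_disjoint]
      exact Set.disjoint_left.2 fun j hj hj' => not_le.2 hj.2 hj'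
    have h2 := norm_add_le (restr (Set.Ico n m) (T x)) (restr (Set.Ici m) (T x))
    rw [← h1] at h2
    linarith
  choose m x hm hx hcx using step
  -- the blocks `[N j, N (j + 1))` are obtained by iterating the step
  let N : ℕ → ℕ := fun j => m^[j] 0
  have hN : ∀ j, N (j + 1) = m (N j) := fun j => Function.iterate_succ_apply' m j 0
  have hNmono : StrictMono N := strictMono_nat_of_lt_succ fun j => by rw [hN]; exact hm _
  let B : ℕ → Set ℕ := fun j => Set.Ico (N j) (N (j + 1))
  have hB : Pairwise (Function.onFun Disjoint B) := hNmono.monotone.pairwise_disjoint_on_Ico_succ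
  have hBi : ∀ i, B i ⊆ Set.Ici i := fun i j hj => (hNmono.id_le i).trans hj.1
  let y : ℕ → StdModule A := fun j => restr (B j) (T (x (N j)))
  have hy : ∀ j, c < ‖y j‖ := by
    intro j
    have := hcx (N j)
    rwa [← hN] at this
  have hy0 : ∀ j, 0 < ‖y j‖ := fun j => hc.trans_lt (hy j)
  have hnorm : ∀ j, ‖((‖y j‖⁻¹ : ℝ) : ℂ)‖ = ‖y j‖⁻¹ := fun j =>
    Complex.norm_of_nonneg (inv_nonneg.2 (hy0 j).le)
  let u : ℕ → StdModule A := fun j => ((‖y j‖⁻¹ : ℝ) : ℂ) • y j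
  have hu : ∀ j, ‖u j‖ ≤ 1 := fun j => by
    rw [norm_smul, hnorm, inv_mul_cancel₀ (hy0 j).ne']
  have huB : ∀ j, restr (B j) (u j) = u j := fun j => by
    rw [map_smul, restr_restr, Set.inter_self]
  have hX : Admissible u := admissible_of_blocks hB hBi hu huB
  have hstate : ∀ j, ∃ φ : State A, φ.1 (ip (y j) (y j)) = ‖ip (y j) (y j)‖ := fun j =>
    exists_state_apply_eq_norm (ip_self_nonneg _) fun h0 => by
      have := norm_sq_eq (y j)
      rw [h0, norm_zero] at this
      exact (hy0 j).ne' (pow_eq_zero_iff two_ne_zero |>.1 this)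
  choose Φ hΦ using hstate
  have hval : ∀ j, c < ‖(Φ j).1 (hX.analysis (T (x (N j))) j)‖ := by
    intro j
    have h1 : ip (u j) (T (x (N j))) = ((‖y j‖⁻¹ : ℝ) : ℂ) • ip (y j) (y j) := by
      rw [← huB, ip_restr_left, ip_smul_left, Complex.star_def, Complex.conj_ofReal]
    rw [hX.analysis_apply, h1, map_smul, hΦ, ← norm_sq_eq, norm_smul, hnorm, Complex.norm_real,
      norm_pow, norm_norm, sq, inv_mul_cancel_left₀ (hy0 j).ne']
    exact hy j
  refine le_trans ?_ (le_iSup_of_le u (le_iSup_of_le hX (le_iSup_of_le Φ le_rfl)))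
  rw [hX.troitskyDist_eq]
  refine le_sInf ?_
  rintro _ ⟨ε, ⟨hε, C, hC, hcov⟩, rfl⟩
  refine ENNReal.ofReal_le_ofReal ?_
  by_contra! hlt
  have hfar : ∀ᶠ k in atTop, ∀ z ∈ C, ‖restr (Set.Ici k) (hX.analysis z)‖ < c - ε := by
    rw [eventually_all_finite hC]
    exact fun z _ => (tendsto_restr_Ici _).eventually (eventually_lt_nhds (sub_pos.2 hlt))
  obtain ⟨k, hk⟩ := hfar.exists
  obtain ⟨z, hz, hzk⟩ := Set.mem_iUnion₂.1
    (hcov ⟨x (N k), mem_closedBall_zero_iff.2 (hx (N k)), rfl⟩)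
  have h1 : ‖(Φ k).1 (hX.analysis (z - T (x (N k))) k)‖ < ε :=
    (norm_apply_le_stateSeminorm Φ _ k).trans_lt hzk
  have h2 : ‖(Φ k).1 (hX.analysis z k)‖ < c - ε := by
    refine ((Φ k).norm_apply_le _).trans_lt (lt_of_le_of_lt ?_ (hk z hz))
    have h3 := norm_apply_le (restr (Set.Ici k) (hX.analysis z)) k
    rwa [restr_apply, Set.indicator_of_mem (Set.mem_Ici.2 le_rfl)] at h3
  rw [map_sub, StdModule.sub_apply, map_sub] at h1
  have h4 := norm_sub_le ((Φ k).1 (hX.analysis z k))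
    ((Φ k).1 (hX.analysis z k) - (Φ k).1 (hX.analysis (T (x (N k))) k))
  rw [sub_sub_cancel] at h4
  linarith [hval k]

/-! ### Measures of noncompactness of operators -/

theorem norm_le_of_mem_imageBall {T : StdModule A →L[ℂ] StdModule A} {y : StdModule A}
    (hy : y ∈ imageBall T) : ‖y‖ ≤ ‖T‖ := by
  obtain ⟨x, hx, rfl⟩ := hy
  exact T.unit_le_opNorm x (mem_closedBall_zero_iff.1 hx)

theorem lambdaOp_le_norm_tail (T : StdModule A →L[ℂ] StdModule A) (n : ℕ) :
    lambdaOp T ≤ ENNReal.ofReal ‖(restr (Set.Ici n)).comp T‖ := by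
  refine (iInf₂_le _ (isFGProjective_coordSubmodule n)).trans (iSup₂_le ?_)
  rintro _ ⟨x, hx, rfl⟩
  refine (infEDist_coordSubmodule_le n (T x)).trans (ENNReal.ofReal_le_ofReal ?_)
  exact ((restr (Set.Ici n)).comp T).unit_le_opNorm x (mem_closedBall_zero_iff.1 hx)

theorem chiOp_eq_lambdaOp (T : StdModule A →L[ℂ] StdModule A) : chiOp T = lambdaOp T := by
  refine le_antisymm (starMNC_hausdorff_le_lambdaMNC fun y => norm_le_of_mem_imageBall) ?_
  refine le_of_forall_lt fun a ha => ?_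
  -- a finite number below `λ_o(T)` lies below the norms of all tails
  obtain ⟨c, hac, hc⟩ := ENNReal.lt_iff_exists_nnreal_btwn.1 ha
  refine hac.trans_le ?_
  rw [← ENNReal.ofReal_coe_nnreal] at hc ⊢
  refine ofReal_le_chiOp T c.coe_nonneg fun n => ?_
  exact (ENNReal.ofReal_lt_ofReal_iff'.1 (hc.trans_le (lambdaOp_le_norm_tail T n))).1

theorem chiOp_le_norm (T : StdModule A →L[ℂ] StdModule A) :
    chiOp T ≤ ENNReal.ofReal ‖T‖ := by
  rw [chiOp_eq_lambdaOp]
  refine (lambdaOp_le_norm_tail T 0).trans (ENNReal.ofReal_le_ofReal ?_)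
  exact ContinuousLinearMap.opNorm_le_bound _ (norm_nonneg _) fun x =>
    (norm_restr_apply_le _ _).trans (T.le_opNorm x)

/-- Inequalities between the measures for the seminorms of admissible sequences pass to the
suprema. -/
theorem starMNC_le {μ : (StdModule A → StdModule A → ℝ) → Set (StdModule A) → ℝ≥0∞}
    {E : Set (StdModule A)} {c : ℝ≥0∞}
    (h : ∀ X, ∀ hX : Admissible X, ∀ Φ, μ (fun x y => hX.seminorm Φ (x - y)) E ≤ c) :
    starMNC μ E ≤ c :=
  iSup_le fun X => iSup_le fun hX => iSup_le fun Φ => hX.troitskyDist_eq Φ ▸ h X hX Φ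

theorem le_starMNC (μ : (StdModule A → StdModule A → ℝ) → Set (StdModule A) → ℝ≥0∞)
    (E : Set (StdModule A)) {X : ℕ → StdModule A} (hX : Admissible X) (Φ : ℕ → State A) :
    μ (fun x y => hX.seminorm Φ (x - y)) E ≤ starMNC μ E := by
  rw [← hX.troitskyDist_eq Φ]
  exact le_iSup_of_le X (le_iSup_of_le hX (le_iSup_of_le Φ le_rfl))

theorem chiOp_le_istrOp (T : StdModule A →L[ℂ] StdModule A) : chiOp T ≤ istrOp T :=
  starMNC_le fun _ hX Φ => (hausdorff_le_istratescu _ _).trans (le_starMNC _ _ hX Φ)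

theorem istrOp_le_alphaOp (T : StdModule A →L[ℂ] StdModule A) : istrOp T ≤ alphaOp T :=
  starMNC_le fun _ hX Φ => (istratescu_le_kuratowski _ _).trans (le_starMNC _ _ hX Φ)

theorem alphaOp_le_two_mul_chiOp (T : StdModule A →L[ℂ] StdModule A) :
    alphaOp T ≤ 2 * chiOp T :=
  starMNC_le fun _ hX Φ => (kuratowski_le_two_mul_hausdorff _ _).trans
    (by gcongr; exact le_starMNC _ _ hX Φ)

theorem imageBall_add_subset (T S : StdModule A →L[ℂ] StdModule A) :
    imageBall (T + S) ⊆ imageBall T + imageBall S := by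
  rintro _ ⟨x, hx, rfl⟩
  exact ⟨T x, ⟨x, hx, rfl⟩, S x, ⟨x, hx, rfl⟩, rfl⟩

theorem imageBall_smul (c : ℂ) (T : StdModule A →L[ℂ] StdModule A) :
    imageBall (c • T) = c • imageBall T := by
  rw [imageBall, imageBall, ← Set.image_smul, Set.image_image]
  rfl

theorem chiOp_add_le (T S : StdModule A →L[ℂ] StdModule A) :
    chiOp (T + S) ≤ chiOp T + chiOp S :=
  starMNC_le fun _ hX Φ => (hausdorff_mono _ (imageBall_add_subset T S)).trans
    ((hausdorff_add_le _ _ _).trans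
      (add_le_add (le_starMNC _ _ hX Φ) (le_starMNC _ _ hX Φ)))

theorem alphaOp_add_le (T S : StdModule A →L[ℂ] StdModule A) :
    alphaOp (T + S) ≤ alphaOp T + alphaOp S :=
  starMNC_le fun _ hX Φ => (kuratowski_mono _ (imageBall_add_subset T S)).trans
    ((kuratowski_add_le _ _ _).trans
      (add_le_add (le_starMNC _ _ hX Φ) (le_starMNC _ _ hX Φ)))

theorem istrOp_add_le (T S : StdModule A →L[ℂ] StdModule A) :
    istrOp (T + S) ≤ istrOp T + istrOp S :=
  starMNC_le fun _ hX Φ => (istratescu_mono _ (imageBall_add_subset T S)).trans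
    ((istratescu_add_le _ _ _).trans
      (add_le_add (le_starMNC _ _ hX Φ) (le_starMNC _ _ hX Φ)))

theorem chiOp_smul_le (T : StdModule A →L[ℂ] StdModule A) {c : ℝ} (hc : 0 < c) :
    chiOp ((c : ℂ) • T) ≤ ENNReal.ofReal c * chiOp T := by
  rw [chiOp, imageBall_smul]
  exact starMNC_le fun _ hX Φ => (hausdorff_smul_le _ hc _).trans
    (by gcongr; exact le_starMNC _ _ hX Φ)

theorem alphaOp_smul_le (T : StdModule A →L[ℂ] StdModule A) {c : ℝ} (hc : 0 < c) :
    alphaOp ((c : ℂ) • T) ≤ ENNReal.ofReal c * alphaOp T := by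
  rw [alphaOp, imageBall_smul]
  exact starMNC_le fun _ hX Φ => (kuratowski_smul_le _ hc _).trans
    (by gcongr; exact le_starMNC _ _ hX Φ)

theorem istrOp_smul_le (T : StdModule A →L[ℂ] StdModule A) {c : ℝ} (hc : 0 < c) :
    istrOp ((c : ℂ) • T) ≤ ENNReal.ofReal c * istrOp T := by
  rw [istrOp, imageBall_smul]
  exact starMNC_le fun _ hX Φ => (istratescu_smul_le _ hc _).trans
    (by gcongr; exact le_starMNC _ _ hX Φ)

/-- Homogeneity follows from the inequality for `c` and for `c⁻¹`. -/
theorem map_smul_eq_of_le {μ : (StdModule A →L[ℂ] StdModule A) → ℝ≥0∞}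
    (h : ∀ T, ∀ c : ℝ, 0 < c → μ ((c : ℂ) • T) ≤ ENNReal.ofReal c * μ T)
    (T : StdModule A →L[ℂ] StdModule A) {c : ℝ} (hc : 0 < c) :
    μ ((c : ℂ) • T) = ENNReal.ofReal c * μ T := by
  refine le_antisymm (h T c hc) ?_
  have hc0 : (c : ℂ) ≠ 0 := by exact_mod_cast hc.ne'
  have h1 := h ((c : ℂ) • T) c⁻¹ (inv_pos.2 hc)
  rw [smul_smul, Complex.ofReal_inv, inv_mul_cancel₀ hc0, one_smul] at h1
  calc ENNReal.ofReal c * μ T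
      ≤ ENNReal.ofReal c * (ENNReal.ofReal c⁻¹ * μ ((c : ℂ) • T)) := by gcongr
    _ = μ ((c : ℂ) • T) := by
      rw [← mul_assoc, ← ENNReal.ofReal_mul hc.le, mul_inv_cancel₀ hc.ne', ENNReal.ofReal_one,
        one_mul]

/-! ### Compact operators -/

theorem IsACompact.neg {K : StdModule A →L[ℂ] StdModule A} (hK : IsACompact K) :
    IsACompact (-K) := by
  refine map_mem_closure continuous_neg hK ?_
  rintro F ⟨n, y, z, hF⟩
  refine ⟨n, fun i => -y i, z, fun x => ?_⟩
  simp only [smul_neg, Finset.sum_neg_distrib, ← hF]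
  rfl

/-- The tails of a finite rank operator tend to `0` in norm. -/
theorem IsFiniteRank.tendsto_norm_tail {F : StdModule A →L[ℂ] StdModule A}
    (hF : IsFiniteRank F) :
    Tendsto (fun n => ‖(restr (Set.Ici n)).comp F‖) atTop (𝓝 0) := by
  obtain ⟨k, y, z, h⟩ := hF
  have hlim : Tendsto (fun n => ∑ i, ‖restr (Set.Ici n) (y i)‖ * ‖z i‖) atTop (𝓝 0) := by
    have := tendsto_finsetSum (Finset.univ : Finset (Fin k)) fun i _ =>
      (tendsto_restr_Ici (y i)).mul_const ‖z i‖
    simpa using this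
  refine squeeze_zero (fun _ => norm_nonneg _) (fun n => ?_) hlim
  refine ContinuousLinearMap.opNorm_le_bound _ (by positivity) fun x => ?_
  rw [ContinuousLinearMap.comp_apply, h, map_sum, Finset.sum_mul]
  refine (norm_sum_le _ _).trans (Finset.sum_le_sum fun i _ => ?_)
  rw [restr_op_smul, mul_assoc]
  exact (norm_op_smul_le _ _).trans (by gcongr; exact norm_ip_le _ _)

theorem IsACompact.lambdaOp_eq_zero {K : StdModule A →L[ℂ] StdModule A} (hK : IsACompact K) :
    lambdaOp K = 0 := by
  refine nonpos_iff_eq_zero.1 (ENNReal.le_of_forall_pos_le_add fun ε hε _ => ?_)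
  have hε' : (0 : ℝ) < ε := hε
  obtain ⟨F, hF, hKF⟩ := Metric.mem_closure_iff.1 hK (ε / 2) (half_pos hε')
  obtain ⟨n, hn⟩ := ((IsFiniteRank.tendsto_norm_tail hF).eventually
    (eventually_lt_nhds (half_pos hε'))).exists
  rw [zero_add, ← ENNReal.ofReal_coe_nnreal]
  refine (lambdaOp_le_norm_tail K n).trans (ENNReal.ofReal_le_ofReal ?_)
  have h1 : (restr (Set.Ici n)).comp K =
      (restr (Set.Ici n)).comp (K - F) + (restr (Set.Ici n)).comp F := by
    rw [← ContinuousLinearMap.comp_add, sub_add_cancel]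
  have h2 : ‖(restr (Set.Ici n)).comp (K - F)‖ ≤ ‖K - F‖ :=
    ContinuousLinearMap.opNorm_le_bound _ (norm_nonneg _) fun x =>
      (norm_restr_apply_le _ _).trans ((K - F).le_opNorm x)
  rw [dist_eq_norm] at hKF
  rw [h1]
  refine (norm_add_le _ _).trans ?_
  linarith

theorem summable_single {A : Type*} [CStarAlgebra A] (j : ℕ) :
    Summable fun i => star ((Pi.single j 1 : ℕ → A) i) * (Pi.single j 1 : ℕ → A) i := by
  refine summable_of_ne_finset_zero (s := {j}) fun i hi => ?_
  have : i ≠ j := by simpa using hi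
  simp [this]

/-- The standard basis vectors of `H_A`. -/
noncomputable def basisVec (A : Type*) [CStarAlgebra A] [PartialOrder A] [StarOrderedRing A]
    (j : ℕ) : StdModule A :=
  StdModule.mk (Pi.single j 1) (summable_single j)

theorem basisVec_apply (i j : ℕ) : basisVec A j i = (Pi.single j 1 : ℕ → A) i := rfl

theorem ip_basisVec (j : ℕ) (x : StdModule A) : ip (basisVec A j) x = x j := by
  rw [ip, tsum_eq_single j fun i hi => by simp [basisVec_apply, hi]]
  simp [basisVec_apply]

/-- The adjoint of `T` turns the coordinates of `T x` into inner products with `x`, so the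
truncations of `T` have finite rank. -/
theorem isFiniteRank_truncation {T : StdModule A →L[ℂ] StdModule A} (hT : IsAdjointable T)
    (n : ℕ) : IsFiniteRank (T - (restr (Set.Ici n)).comp T) := by
  obtain ⟨-, S, hS⟩ := hT
  refine ⟨n, fun j => basisVec A j, fun j => S (basisVec A j), fun x => ?_⟩
  have hcoef : ∀ j, ip (S (basisVec A j)) x = T x j := by
    intro j
    rw [← star_ip, ← hS, star_ip, ip_basisVec]
  have hsub : (T - (restr (Set.Ici n)).comp T) x = T x - restr (Set.Ici n) (T x) := rfl
  refine StdModule.ext fun i => ?_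
  rw [hsub, StdModule.sub_apply, restr_apply, StdModule.sum_apply]
  simp only [hcoef, StdModule.op_smul_apply, basisVec_apply]
  by_cases hi : i < n
  · rw [Set.indicator_of_notMem (by simpa using hi), sub_zero,
      Finset.sum_eq_single (⟨i, hi⟩ : Fin n)]
    · simp
    · intro j _ hj
      have : i ≠ j := fun e => hj (Fin.ext e.symm)
      simp [this]
    · simp
  · rw [Set.indicator_of_mem (by simpa using hi), sub_self, Finset.sum_eq_zero]
    intro j _
    have : i ≠ j := fun e => hi (e ▸ j.2)
    simp [this]

theorem isACompact_of_lambdaOp_eq_zero {T : StdModule A →L[ℂ] StdModule A}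
    (hT : IsAdjointable T) (h : lambdaOp T = 0) : IsACompact T := by
  refine Metric.mem_closure_iff.2 fun ε hε => ?_
  obtain ⟨n, hn⟩ : ∃ n, ‖(restr (Set.Ici n)).comp T‖ ≤ ε / 2 := by
    by_contra! hcon
    have h1 := ofReal_le_chiOp T (half_pos hε).le hcon
    rw [chiOp_eq_lambdaOp, h, nonpos_iff_eq_zero, ENNReal.ofReal_eq_zero] at h1
    linarith
  refine ⟨_, isFiniteRank_truncation hT n, ?_⟩
  rw [dist_eq_norm, sub_sub_cancel]
  linarith

theorem map_add_eq_of_subadditive {μ : (StdModule A →L[ℂ] StdModule A) → ℝ≥0∞}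
    (hadd : ∀ T S, μ (T + S) ≤ μ T + μ S) (hcomp : ∀ K, IsACompact K → μ K = 0)
    (T : StdModule A →L[ℂ] StdModule A) {K : StdModule A →L[ℂ] StdModule A}
    (hK : IsACompact K) : μ (T + K) = μ T := by
  refine le_antisymm ((hadd T K).trans_eq (by rw [hcomp K hK, add_zero])) ?_
  have h := hadd (T + K) (-K)
  rwa [add_neg_cancel_right, hcomp _ hK.neg, add_zero] at h

theorem IsACompact.chiOp_eq_zero {K : StdModule A →L[ℂ] StdModule A} (hK : IsACompact K) :
    chiOp K = 0 := by
  rw [chiOp_eq_lambdaOp, hK.lambdaOp_eq_zero]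

theorem IsACompact.alphaOp_eq_zero {K : StdModule A →L[ℂ] StdModule A} (hK : IsACompact K) :
    alphaOp K = 0 :=
  nonpos_iff_eq_zero.1 ((alphaOp_le_two_mul_chiOp K).trans_eq (by rw [hK.chiOp_eq_zero, mul_zero]))

theorem IsACompact.istrOp_eq_zero {K : StdModule A →L[ℂ] StdModule A} (hK : IsACompact K) :
    istrOp K = 0 :=
  nonpos_iff_eq_zero.1 ((istrOp_le_alphaOp K).trans_eq hK.alphaOp_eq_zero)

theorem isACompact_of_chiOp_le {T : StdModule A →L[ℂ] StdModule A} (hT : IsAdjointable T)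
    {a : ℝ≥0∞} (h : chiOp T ≤ a) (ha : a = 0) : IsACompact T :=
  isACompact_of_lambdaOp_eq_zero hT <| by
    rw [← chiOp_eq_lambdaOp, ← nonpos_iff_eq_zero, ← ha]
    exact h

end HilbertMNC

theorem mainTheorem3 {A : Type*} [CStarAlgebra A] [PartialOrder A] [StarOrderedRing A]
    (T S : HilbertMNC.StdModule A →L[ℂ] HilbertMNC.StdModule A)
    (hT : HilbertMNC.IsAdjointable T) (hS : HilbertMNC.IsAdjointable S) :
    -- subadditivity and positive homogeneity
    (∀ μ ∈ ({HilbertMNC.chiOp, HilbertMNC.alphaOp, HilbertMNC.istrOp} :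
        Set ((HilbertMNC.StdModule A →L[ℂ] HilbertMNC.StdModule A) → ℝ≥0∞)),
      μ (T + S) ≤ μ T + μ S ∧
      ∀ c : ℝ, 0 < c → μ ((c : ℂ) • T) = ENNReal.ofReal c * μ T) ∧
    -- comparison
    (HilbertMNC.chiOp T = HilbertMNC.lambdaOp T ∧
      HilbertMNC.lambdaOp T ≤ HilbertMNC.istrOp T ∧
      HilbertMNC.istrOp T ≤ HilbertMNC.alphaOp T ∧
      HilbertMNC.alphaOp T ≤ 2 * HilbertMNC.chiOp T) ∧
    -- bounds by the norm
    (HilbertMNC.chiOp T ≤ ENNReal.ofReal ‖T‖ ∧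
      HilbertMNC.alphaOp T ≤ 2 * ENNReal.ofReal ‖T‖ ∧
      HilbertMNC.istrOp T ≤ 2 * ENNReal.ofReal ‖T‖) ∧
    -- characterization of `A`-compactness
    ((HilbertMNC.IsACompact T ↔ HilbertMNC.lambdaOp T = 0) ∧
      ∀ μ ∈ ({HilbertMNC.chiOp, HilbertMNC.alphaOp, HilbertMNC.istrOp} :
          Set ((HilbertMNC.StdModule A →L[ℂ] HilbertMNC.StdModule A) → ℝ≥0∞)),
        (HilbertMNC.IsACompact T ↔ μ T = 0)) ∧
    -- invariance under `A`-compact perturbations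
    (∀ K : HilbertMNC.StdModule A →L[ℂ] HilbertMNC.StdModule A, HilbertMNC.IsACompact K →
      HilbertMNC.lambdaOp (T + K) = HilbertMNC.lambdaOp T ∧
      ∀ μ ∈ ({HilbertMNC.chiOp, HilbertMNC.alphaOp, HilbertMNC.istrOp} :
          Set ((HilbertMNC.StdModule A →L[ℂ] HilbertMNC.StdModule A) → ℝ≥0∞)),
        μ (T + K) = μ T) := by
  have two_mul_norm : 2 * HilbertMNC.chiOp T ≤ 2 * ENNReal.ofReal ‖T‖ := by
    gcongr
    exact HilbertMNC.chiOp_le_norm T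
  refine ⟨?_, ⟨HilbertMNC.chiOp_eq_lambdaOp T, ?_, HilbertMNC.istrOp_le_alphaOp T,
    HilbertMNC.alphaOp_le_two_mul_chiOp T⟩, ⟨HilbertMNC.chiOp_le_norm T, ?_, ?_⟩, ⟨?_, ?_⟩, ?_⟩
  · rintro μ (rfl | rfl | rfl)
    · exact ⟨HilbertMNC.chiOp_add_le T S, fun c hc =>
        HilbertMNC.map_smul_eq_of_le (fun T _ => HilbertMNC.chiOp_smul_le T) T hc⟩
    · exact ⟨HilbertMNC.alphaOp_add_le T S, fun c hc =>
        HilbertMNC.map_smul_eq_of_le (fun T _ => HilbertMNC.alphaOp_smul_le T) T hc⟩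
    · exact ⟨HilbertMNC.istrOp_add_le T S, fun c hc =>
        HilbertMNC.map_smul_eq_of_le (fun T _ => HilbertMNC.istrOp_smul_le T) T hc⟩
  · rw [← HilbertMNC.chiOp_eq_lambdaOp]
    exact HilbertMNC.chiOp_le_istrOp T
  · exact (HilbertMNC.alphaOp_le_two_mul_chiOp T).trans two_mul_norm
  · exact (HilbertMNC.istrOp_le_alphaOp T).trans
      ((HilbertMNC.alphaOp_le_two_mul_chiOp T).trans two_mul_norm)
  · exact ⟨HilbertMNC.IsACompact.lambdaOp_eq_zero,
      HilbertMNC.isACompact_of_lambdaOp_eq_zero hT⟩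
  · rintro μ (rfl | rfl | rfl)
    · exact ⟨HilbertMNC.IsACompact.chiOp_eq_zero,
        HilbertMNC.isACompact_of_chiOp_le hT le_rfl⟩
    · exact ⟨HilbertMNC.IsACompact.alphaOp_eq_zero,
        HilbertMNC.isACompact_of_chiOp_le hT 
          ((HilbertMNC.chiOp_le_istrOp T).trans (HilbertMNC.istrOp_le_alphaOp T))⟩
    · exact ⟨HilbertMNC.IsACompact.istrOp_eq_zero,
        HilbertMNC.isACompact_of_chiOp_le hT (HilbertMNC.chiOp_le_istrOp T)⟩
  · intro K hK
    refine ⟨?_, ?_⟩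
    · rw [← HilbertMNC.chiOp_eq_lambdaOp, ← HilbertMNC.chiOp_eq_lambdaOp]
      exact HilbertMNC.map_add_eq_of_subadditive HilbertMNC.chiOp_add_le
        (fun _ => HilbertMNC.IsACompact.chiOp_eq_zero) T hK
    · rintro μ (rfl | rfl | rfl)
      · exact HilbertMNC.map_add_eq_of_subadditive HilbertMNC.chiOp_add_le
          (fun _ => HilbertMNC.IsACompact.chiOp_eq_zero) T hK
      · exact HilbertMNC.map_add_eq_of_subadditive HilbertMNC.alphaOp_add_le
          (fun _ => HilbertMNC.IsACompact.alphaOp_eq_zero) T hK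
      · exact HilbertMNC.map_add_eq_of_subadditive HilbertMNC.istrOp_add_le
          (fun _ => HilbertMNC.IsACompact.istrOp_eq_zero) T hK
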